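/- Let $\mathcal I_{\mathbb N}$ be the symmetric inverse monoid on $\mathbb N$, that is, the inverse semigroup of all bijections between subsets of $\mathbb N$, with composition and inversion of binary relations as operations; let $S$ be the semigroup obtained from $\mathcal I_{\mathbb N}$ by forgetting the inversion. Define the following topologies on the set $\mathcal I_{\mathbb N}$, where $x,y$ range over $\mathbb N$. $\mathcal{CPT}$ is generated by the sets $\{f : (x,y)\in f\}$ and $\{f : (x,y)\notin f\}$. $\mathcal{LPT}$ is generated by the sets $\{f : (x,y)\in f\}$ and $\{f : x\notin\operatorname{dom} f\}$. $\mathcal{RPT}=\{U^{-1} : U\in\mathcal{LPT}\}$, where $U^{-1}=\{f^{-1} : f\in U\}$. The inverse pointwise topology $\mathcal{IPT}$ is generated by $\mathcal{LPT}\cup\mathcal{RPT}$. A topology is compatible with a semigroup if the multiplication is (jointly) continuous, and compatible with an inverse semigroup if both the multiplication and the inversion are continuous. It is semicompatible with a semigroup or an inverse semigroup if all left and all right translations are continuous. A topology is Fréchet if all singletons are closed. For $A$ a semigroup or an inverse semigroup, let $\mathcal{MF}(A)$ be the intersection of all Fréchet topologies semicompatible with $A$; let $\mathcal{FM}(A)$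 and $\mathcal{HM}(A)$ be the intersections of all Fréchet, respectively all Hausdorff, topologies compatible with $A$; and let $\mathcal{SCC}(A)$ be the topology generated by the union of all second countable topologies compatible with $A$. **Theorem.** The topology $\mathcal{IPT}$ is Polish, and it is the only second countable Fréchet topology compatible with the inverse semigroup $\mathcal I_{\mathbb N}$. Moreover $$\mathcal{CPT}=\mathcal{MF}(\mathcal I_{\mathbb N})\subsetneq \mathcal{FM}(\mathcal I_{\mathbb N})=\mathcal{HM}(\mathcal I_{\mathbb N})=\mathcal{SCC}(\mathcal I_{\mathbb N})=\mathcal{IPT},$$ $$\mathcal{CPT}=\mathcal{MF}(S)\subsetneq \mathcal{LPT}\cap\mathcal{RPT}=\mathcal{FM}(S)=\mathcal{HM}(S)\subsetneq \mathcal{SCC}(S)=\mathcal{IPT},$$ and every semigroup homomorphism from $(S,\mathcal{IPT})$ to a second countable topological semigroup is continuous. -/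

import Mathlib

/-! Inverse semigroups, in the signature with a binary multiplication and a unary inversion.
The underlying semigroup, with the unary operation removed, is `InverseSemigroup.toSemigroup`. -/

/-- Inverse semigroups: `(a⁻¹)⁻¹ = a`, `a a⁻¹ a = a`, and the elements `a a⁻¹` commute. -/
class InverseSemigroup (S : Type*) extends Semigroup S, InvolutiveInv S where
  mul_inv_mul : ∀ a : S, a * a⁻¹ * a = a
  mul_inv_comm : ∀ a b : S, a * a⁻¹ * (b * b⁻¹) = b * b⁻¹ * (a * a⁻¹)

/-! In Mathlib's order on `TopologicalSpace S`, `t ≤ t'` means that every `t'`-open set is `t`-open.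
Hence `sSup A` (and `t ⊔ t'`) is the intersection of the topologies as families of open sets, and
`sInf A` (and `t ⊓ t'`) is the topology generated by their union. -/

/-- The family of open sets of a topology. -/
def openFamily {S : Type*} (t : TopologicalSpace S) : Set (Set S) := {U | @IsOpen S t U}

namespace SemigroupTopology

/-- `t` is compatible with the semigroup `S`: multiplication is jointly continuous. -/
def Compatible (S : Type*) [Semigroup S] (t : TopologicalSpace S) : Prop :=
  @ContinuousMul S t _

/-- `t` is semicompatible with the semigroup `S`: all left and right translations are continuous. -/
def Semicompatible (S : Type*) [Semigroup S] (t : TopologicalSpace S) : Prop :=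
  @SeparatelyContinuousMul S t _

/-- Minimum Fréchet topology: the intersection of all semicompatible `T₁` topologies. -/
def MF (S : Type*) [Semigroup S] : TopologicalSpace S :=
  sSup {t | @T1Space S t ∧ Semicompatible S t}

/-- Fréchet-Markov topology: the intersection of all compatible `T₁` topologies. -/
def FM (S : Type*) [Semigroup S] : TopologicalSpace S :=
  sSup {t | @T1Space S t ∧ Compatible S t}

/-- Hausdorff-Markov topology: the intersection of all compatible Hausdorff topologies. -/
def HM (S : Type*) [Semigroup S] : TopologicalSpace S :=
  sSup {t | @T2Space S t ∧ Compatible S t}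

/-- Second countable continuity topology: the topology generated by the union of all
second countable compatible topologies. -/
def SCC (S : Type*) [Semigroup S] : TopologicalSpace S :=
  sInf {t | @SecondCountableTopology S t ∧ Compatible S t}

end SemigroupTopology

namespace InverseSemigroupTopology

/-- `t` is compatible with the inverse semigroup `S`: multiplication is jointly continuous and
inversion is continuous. -/
def Compatible (S : Type*) [InverseSemigroup S] (t : TopologicalSpace S) : Prop :=
  @ContinuousMul S t _ ∧ @ContinuousInv S t _

/-- `t` is semicompatible with the inverse semigroup `S` if it is semicompatible with the
underlying semigroup (continuity of inversion is not part of this notion). -/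
def Semicompatible (S : Type*) [InverseSemigroup S] (t : TopologicalSpace S) : Prop :=
  SemigroupTopology.Semicompatible S t

/-- Minimum Fréchet topology: the intersection of all semicompatible `T₁` topologies. -/
def MF (S : Type*) [InverseSemigroup S] : TopologicalSpace S :=
  sSup {t | @T1Space S t ∧ Semicompatible S t}

/-- Fréchet-Markov topology: the intersection of all compatible `T₁` topologies. -/
def FM (S : Type*) [InverseSemigroup S] : TopologicalSpace S :=
  sSup {t | @T1Space S t ∧ Compatible S t}

/-- Hausdorff-Markov topology: the intersection of all compatible Hausdorff topologies. -/
def HM (S : Type*) [InverseSemigroup S] : TopologicalSpace S :=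
  sSup {t | @T2Space S t ∧ Compatible S t}

/-- Second countable continuity topology: the topology generated by the union of all
second countable compatible topologies. -/
def SCC (S : Type*) [InverseSemigroup S] : TopologicalSpace S :=
  sInf {t | @SecondCountableTopology S t ∧ Compatible S t}

end InverseSemigroupTopology

/-- The universe of the symmetric inverse monoid: bijections between subsets of `X`.
For `f : SymInv X`, `f x = some y` means `(x, y) ∈ f`, and `f x = none` means `x ∉ dom f`. -/
abbrev SymInv (X : Type*) := X ≃. X

namespace SymInv

/-- Composition (from left to right, `f * g` is first `f`, then `g`) and inversion of partial
bijections, as binary relations. -/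
instance instInverseSemigroup (X : Type*) : InverseSemigroup (SymInv X) where
  mul f g := PEquiv.trans f g
  mul_assoc f g h := PEquiv.trans_assoc f g h
  inv f := PEquiv.symm f
  inv_inv f := PEquiv.symm_symm f
  mul_inv_mul f := by
    refine PEquiv.ext fun x => ?_
    change (((f x).bind (PEquiv.symm f)).bind f) = f x
    cases h : f x with
    | none => rfl
    | some y =>
      have h2 : PEquiv.symm f y = some x := (PEquiv.eq_some_iff f).2 h
      change (PEquiv.symm f y).bind f = some y
      rw [h2]
      exact h
  mul_inv_comm f g := by
    classical
    change PEquiv.trans (PEquiv.trans f f.symm) (PEquiv.trans g g.symm)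
      = PEquiv.trans (PEquiv.trans g g.symm) (PEquiv.trans f f.symm)
    rw [PEquiv.self_trans_symm, PEquiv.self_trans_symm]
    refine PEquiv.ext fun x => Option.ext fun y => ?_
    change y ∈ (PEquiv.trans _ _) x ↔ y ∈ (PEquiv.trans _ _) x
    simp only [PEquiv.mem_trans, PEquiv.mem_ofSet_iff]
    grind

/-- The partial pointwise topology on the set of partial functions from `X` to `X` (encoded as
functions `X → Option X`), generated by the sets `{f | (x, y) ∈ f}` and `{f | x ∉ dom f}`. -/
def PPT (X : Type*) : TopologicalSpace (X → Option X) :=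
  TopologicalSpace.generateFrom
    ({U | ∃ x y : X, U = {f | f x = some y}} ∪ {U | ∃ x : X, U = {f | f x = none}})

/-- The complemented pointwise topology, generated by the sets `{f | (x, y) ∈ f}` and
`{f | (x, y) ∉ f}`. -/
def CPT (X : Type*) : TopologicalSpace (SymInv X) :=
  TopologicalSpace.generateFrom
    ({U | ∃ x y : X, U = {f | f x = some y}} ∪ {U | ∃ x y : X, U = {f | f x ≠ some y}})

/-- The left pointwise topology: the subspace topology inherited from the partial pointwise
topology, each partial bijection being regarded as a partial function. -/
def LPT (X : Type*) : TopologicalSpace (SymInv X) :=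
  TopologicalSpace.induced (fun f => (f : X → Option X)) (PPT X)

/-- The right pointwise topology, whose open sets are the inverses `U⁻¹` of the open sets `U`
of the left pointwise topology (as inversion is an involution, `U⁻¹` is also the preimage of `U`
under inversion). -/
def RPT (X : Type*) : TopologicalSpace (SymInv X) :=
  TopologicalSpace.induced (fun f : SymInv X => f⁻¹) (LPT X)

/-- The inverse pointwise topology, generated by the union of the left and the right pointwise
topologies. -/
def IPT (X : Type*) : TopologicalSpace (SymInv X) :=
  TopologicalSpace.generateFrom (openFamily (LPT X) ∪ openFamily (RPT X))

/-- The topology whose open sets are those open in both the left and the right pointwise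
topologies. -/
def interLRPT (X : Type*) : TopologicalSpace (SymInv X) := LPT X ⊔ RPT X

end SymInv

/-! Sandwiching a Fréchet topology between generating sets gives the lower bounds, and automatic
continuity gives the upper one.

Multiplying `f` on both sides by one-point identities leaves `{(x, y)}` or the empty map. So a
semicompatible topology with closed singletons refines `CPT` (`le_CPT`), and `CPT` is itself such a
topology. If inversion is continuous too, `f * f⁻¹` detects whether `x` lies in the domain, which
forces refinement of `IPT` (`le_IPT`).

For the bare semigroup, fix `s`, a point `x` outside its domain and `y` outside its range. If
neither `x ∉ dom f` nor `y ∉ ran f` held near `s`, maps near `s` would send `x` to almost every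
point of an infinite set and reach `y` from almost every point of another. A fixed partial bijection
`g` between these sets would then give `f * g * f'` containing `(x, y)` with `f`, `f'` arbitrarily
near `s`, although `s * g * s` omits it. Hence near each `s` the topology refines `LPT` or `RPT`
(`le_interLRPT`).

Automatic continuity rests on the symmetric group: if countably many translates of a symmetric set
`W` cover it, a fixed power of `W` contains the pointwise stabilizer of a finite set
(`exists_finite_stabilizer_subset`). Each partial bijection is a compression of a permutation of two
copies of the base set, and this carries the result over to the monoid
(`continuous_of_secondCountable`). -/

section

open Set Pointwise Topology

/-! ### Almost disjoint families and extension of injections -/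

/-- An almost disjoint family of infinite sets, indexed by the continuum. -/
theorem exists_almost_disjoint (β : Type*) [Countable β] [Infinite β] :
    ∃ I : Set ℕ → Set β, (∀ s, (I s).Infinite) ∧ ∀ s u, s ≠ u → (I s ∩ I u).Finite := by
  classical
  obtain ⟨e⟩ := nonempty_equiv_of_countable (α := ℕ × Finset ℕ) (β := β)
  -- The branch of the binary tree given by the initial segments of `s`; two branches separate at
  -- the first point where the sets differ.
  refine ⟨fun s => Set.range fun n => e (n, (Finset.range n).filter (· ∈ s)), fun s => ?_, ?_⟩
  · exact Set.infinite_range_of_injective fun a b h => by simpa using congrArg Prod.fst (e.injective h)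
  · intro s u hsu
    obtain ⟨k, hk⟩ : ∃ k, ¬ (k ∈ s ↔ k ∈ u) := by
      by_contra! h
      exact hsu (Set.ext h)
    refine ((Set.finite_Iic k).image fun n => e (n, (Finset.range n).filter (· ∈ s))).subset ?_
    rintro _ ⟨⟨n, rfl⟩, ⟨m, hm⟩⟩
    obtain ⟨rfl, h2⟩ := Prod.mk.inj (e.injective hm)
    refine ⟨m, ?_, rfl⟩
    by_contra hlt
    have := congrArg (k ∈ ·) h2
    simp only [Finset.mem_filter, Finset.mem_range, eq_iff_iff] at this
    simp only [mem_Iic, not_le] at hlt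
    tauto

/-- In an almost disjoint family, two members never cover another infinite member. -/
theorem exists_third {β : Type*} {I : Set ℕ → Set β} (h1 : ∀ s, (I s).Infinite)
    (h2 : ∀ s u, s ≠ u → (I s ∩ I u).Finite) (s u : Set ℕ) : (I s ∪ I u)ᶜ.Infinite := by
  obtain ⟨w, hw⟩ := Set.Infinite.exists_notMem_finite (Set.infinite_univ (α := Set ℕ))
    (Set.toFinite {s, u})
  simp only [mem_univ, mem_insert_iff, mem_singleton_iff, not_or, true_and] at hw
  have : (I w \ ((I w ∩ I s) ∪ (I w ∩ I u))).Infinite :=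
    (h1 w).sdiff ((h2 _ _ hw.1).union (h2 _ _ hw.2))
  refine this.mono ?_
  rintro x ⟨hx, hx'⟩
  simp only [mem_union, mem_inter_iff, not_or, mem_compl_iff] at hx' ⊢
  tauto

theorem exists_bijOn {α β : Type*} [Countable α] [Countable β] [Nonempty β] {X : Set α} {Y : Set β}
    (hX : X.Infinite) (hY : Y.Infinite) : ∃ f : α → β, BijOn f X Y := by
  classical
  have := hX.to_subtype
  have := hY.to_subtype
  obtain ⟨e⟩ := nonempty_equiv_of_countable (α := X) (β := Y)
  refine ⟨fun x => if h : x ∈ X then e ⟨x, h⟩ else Classical.arbitrary β, ?_, ?_, ?_⟩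
  · intro x hx
    simp [hx]
  · intro x hx y hy h
    simpa [hx, hy, Subtype.coe_inj] using h
  · intro y hy
    refine ⟨e.symm ⟨y, hy⟩, (e.symm ⟨y, hy⟩).2, ?_⟩
    simp

/-- Extension of an injection between parts of `B` to a permutation supported on `B`. -/
theorem exists_perm_extend {α : Type*} [Countable α] {B P : Set α} {f : α → α} (hPB : P ⊆ B)
    (hfB : MapsTo f P B) (hf : InjOn f P) (h1 : (B \ P).Infinite) (h2 : (B \ f '' P).Infinite) :
    ∃ a : Equiv.Perm α, (∀ x ∈ P, a x = f x) ∧ ∀ x ∉ B, a x = x := by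
  classical
  have : Nonempty α := h1.nonempty.to_type
  obtain ⟨g, hg⟩ := exists_bijOn h1 h2
  let k : α → α := fun x => if x ∈ P then f x else if x ∈ B then g x else x
  have kP : ∀ x ∈ P, k x = f x := fun x hx => by simp [k, hx]
  have kB : ∀ x ∈ B \ P, k x = g x := fun x hx => by simp [k, hx.1, hx.2]
  have kC : ∀ x ∉ B, k x = x := fun x hx => by
    simp only [k, if_neg hx, if_neg fun h => hx (hPB h)]
  have b1 : BijOn k P (f '' P) := hf.bijOn_image.congr fun x hx => (kP x hx).symm
  have b2 : BijOn k (B \ P) (B \ f '' P) := hg.congr fun x hx => (kB x hx).symm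
  have b3 : BijOn k Bᶜ Bᶜ := (bijOn_id _).congr fun x hx => (kC x hx).symm
  have hinj : InjOn k (P ∪ B \ P) := by
    rw [injOn_union (disjoint_sdiff_right)]
    exact ⟨b1.injOn, b2.injOn, fun x hx y hy h =>
      (b2.mapsTo hy).2 (h ▸ b1.mapsTo hx)⟩
  have b4 := b1.union b2 hinj
  rw [union_sdiff_cancel hPB, union_sdiff_cancel hfB.image_subset] at b4
  have hinj' : InjOn k (B ∪ Bᶜ) := by
    rw [injOn_union disjoint_compl_right]
    exact ⟨b4.injOn, b3.injOn, fun x hx y hy h => (b3.mapsTo hy) (h ▸ b4.mapsTo hx)⟩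
  have b5 := b4.union b3 hinj'
  rw [union_compl_self, bijOn_univ] at b5
  exact ⟨Equiv.ofBijective k b5, kP, kC⟩

/-! ### Factoring permutations supported on a union -/

/-- Permutations of `α` supported on `B`. -/
def permSupportedOn {α : Type*} (B : Set α) : Subgroup (Equiv.Perm α) :=
  fixingSubgroup (Equiv.Perm α) Bᶜ

theorem mem_permSupportedOn {α : Type*} {B : Set α} {σ : Equiv.Perm α} :
    σ ∈ permSupportedOn B ↔ ∀ x ∉ B, σ x = x := by
  simp [permSupportedOn, mem_fixingSubgroup_iff]

/-- One of the two cases of the decomposition of permutations supported on a union. -/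
theorem mem_mul_of_infinite {α : Type*} [Countable α] {B C : Set α} {σ : Equiv.Perm α}
    (hσ : σ ∈ permSupportedOn (B ∪ C)) (hJ : (B ∩ C ∩ σ ⁻¹' B).Infinite) :
    ∃ a ∈ permSupportedOn B, ∃ c ∈ permSupportedOn C, ∃ a' ∈ permSupportedOn B,
      σ = a * c * a' := by
  have : Nonempty α := hJ.nonempty.to_type
  obtain ⟨f, hf⟩ := exists_bijOn (Set.infinite_univ (α := ℕ)) hJ
  obtain ⟨q, hq⟩ := exists_injective_nat α
  set J := B ∩ C ∩ σ ⁻¹' B with hJdef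
  -- Even indices receive the image; the odd ones stay free, so that the complements needed for
  -- extension to permutations are infinite.
  let ι : α → α := fun x => f (2 * q x)
  have hιJ : ∀ x, ι x ∈ J := fun x => hf.mapsTo (mem_univ _)
  have hι : Function.Injective ι := fun x y h => by
    have := hf.injOn (mem_univ _) (mem_univ _) h
    exact hq (by omega)
  let odd : ℕ → α := fun n => f (2 * n + 1)
  have hodd : Function.Injective odd := fun x y h => by
    have := hf.injOn (mem_univ _) (mem_univ _) h
    omega
  have hoddJ : ∀ n, odd n ∈ J := fun n => hf.mapsTo (mem_univ _)
  have hne : ∀ n x, ι x ≠ odd n := fun n x h => by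
    have := hf.injOn (mem_univ _) (mem_univ _) h
    omega
  have hBP : (B \ (B \ C)).Infinite := hJ.mono fun x hx => ⟨hx.1.1, fun h => h.2 hx.1.2⟩
  obtain ⟨b, hb1, hb2⟩ := exists_perm_extend (B := B) (P := B \ C) (f := ι) sdiff_subset
    (fun x _ => (hιJ x).1.1) hι.injOn hBP
    ((infinite_range_of_injective hodd).mono (by
      rintro _ ⟨n, rfl⟩
      refine ⟨(hoddJ n).1.1, ?_⟩
      rintro ⟨x, -, hx⟩
      exact hne n x hx))
  obtain ⟨a, ha1, ha2⟩ := exists_perm_extend (B := B) (P := B \ C) (f := σ ∘ ι) sdiff_subset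
    (fun x _ => (hιJ x).2) (σ.injective.comp hι).injOn hBP
    ((infinite_range_of_injective (σ.injective.comp hodd)).mono (by
      rintro _ ⟨n, rfl⟩
      refine ⟨(hoddJ n).2, ?_⟩
      rintro ⟨x, -, hx⟩
      exact hne n x (σ.injective hx)))
  have haS : a ∈ permSupportedOn B := mem_permSupportedOn.2 ha2
  have hbS : b ∈ permSupportedOn B := mem_permSupportedOn.2 hb2
  -- On `B \ C`, `b` is `ι` and `a` is `σ ∘ ι`, so the middle factor is trivial there and is
  -- supported on `C`.
  refine ⟨a, haS, a⁻¹ * σ * b, ?_, b⁻¹, inv_mem hbS, by group⟩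
  rw [mem_permSupportedOn] at hσ ⊢
  intro x hx
  rw [Equiv.Perm.mul_apply, Equiv.Perm.mul_apply, Equiv.Perm.inv_eq_iff_eq]
  by_cases hxB : x ∈ B
  · rw [hb1 x ⟨hxB, hx⟩, ha1 x ⟨hxB, hx⟩]
    rfl
  · rw [hb2 x hxB, ha2 x hxB, hσ x (by simp [hxB, hx])]

/-- `σ` maps the infinite set `B ∩ C` into `B ∪ C`, so infinitely many of its points land in `B` or
infinitely many in `C`. -/
theorem mem_mul_of_mem_union {α : Type*} [Countable α] {B C : Set α} {σ : Equiv.Perm α}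
    (hσ : σ ∈ permSupportedOn (B ∪ C)) (hBC : (B ∩ C).Infinite) :
    (∃ a ∈ permSupportedOn B, ∃ c ∈ permSupportedOn C, ∃ a' ∈ permSupportedOn B,
      σ = a * c * a') ∨ ∃ c ∈ permSupportedOn C, ∃ a ∈ permSupportedOn B,
      ∃ c' ∈ permSupportedOn C, σ = c * a * c' := by
  have hmaps : ∀ x ∈ B ∪ C, σ x ∈ B ∪ C := fun x hx => by
    by_contra h
    have := mem_permSupportedOn.1 hσ _ h
    rw [σ.injective this] at h
    exact h hx
  have : ((B ∩ C ∩ σ ⁻¹' B) ∪ (C ∩ B ∩ σ ⁻¹' C)).Infinite := hBC.mono fun x hx => by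
    rcases hmaps x (.inl hx.1) with h | h
    · exact .inl ⟨hx, h⟩
    · exact .inr ⟨hx.symm, h⟩
  rcases infinite_union.1 this with h | h
  · exact .inl (mem_mul_of_infinite hσ h)
  · exact .inr (mem_mul_of_infinite (by rwa [union_comm]) h)

/-! ### Syndetic sets in the symmetric group -/

/-- A symmetric set of which countably many left translates cover the group. -/
structure IsSyndetic {G : Type*} [Group G] (W : Set G) : Prop where
  inv_eq : W⁻¹ = W
  cover : ∃ c : ℕ → G, ∀ g, ∃ n, (c n)⁻¹ * g ∈ W

namespace IsSyndetic

theorem inv_mem_pow {G : Type*} [Group G] {W : Set G} (hW : IsSyndetic W) {k : ℕ} {g : G}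
    (hg : g ∈ W ^ k) : g⁻¹ ∈ W ^ k := by
  have : (W ^ k)⁻¹ = W ^ k := by rw [← inv_pow, hW.inv_eq]
  rw [← this]
  exact Set.inv_mem_inv.2 hg

theorem mul_mem_pow {G : Type*} [Group G] {W : Set G} {k l : ℕ} {g h : G}
    (hg : g ∈ W ^ k) (hh : h ∈ W ^ l) : g * h ∈ W ^ (k + l) := by
  rw [pow_add]
  exact Set.mul_mem_mul hg hh

theorem inv_mul_mem {G : Type*} [Group G] {W : Set G} (hW : IsSyndetic W) {c g h : G}
    (hg : c⁻¹ * g ∈ W) (hh : c⁻¹ * h ∈ W) : g⁻¹ * h ∈ W ^ 2 := by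
  have h1 : (c⁻¹ * g)⁻¹ ∈ W := by
    rw [← hW.inv_eq]
    exact Set.inv_mem_inv.2 hg
  rw [pow_two]
  have := Set.mul_mem_mul h1 hh
  rwa [show (c⁻¹ * g)⁻¹ * (c⁻¹ * h) = g⁻¹ * h by group] at this

/-- Pigeonhole principle for families indexed by the continuum. -/
theorem exists_ne_inv_mul_mem {G : Type*} [Group G] {W : Set G} (hW : IsSyndetic W)
    (x : Set ℕ → G) : ∃ s u, s ≠ u ∧ (x s)⁻¹ * x u ∈ W ^ 2 := by
  obtain ⟨c, hc⟩ := hW.cover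
  choose n hn using hc
  -- The index of a covering translate cannot depend injectively on a subset of `ℕ`.
  have := Function.cantor_injective (fun s => n (x s))
  simp only [Function.Injective, not_forall] at this
  obtain ⟨s, u, h1, h2⟩ := this
  refine ⟨s, u, h2, hW.inv_mul_mem (hn (x s)) ?_⟩
  rw [h1]
  exact hn _

/-- Diagonal argument: if the translate by `c m` missed some `ρ m` on slice `m`, for every `m`, the
permutation glued from all `ρ m` would lie in no translate. Dividing by an element that is trivial
on the good slice removes `c m`. -/
theorem exists_full {β : Type*} {W : Set (Equiv.Perm (ℕ × β))} (hW : IsSyndetic W) :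
    ∃ m, ∀ ρ : Equiv.Perm β, ∃ v ∈ W ^ 2, ∀ z, v (m, z) = (m, ρ z) := by
  obtain ⟨c, hc⟩ := hW.cover
  have key : ∃ m, ∀ ρ : Equiv.Perm β, ∃ v : Equiv.Perm (ℕ × β), (c m)⁻¹ * v ∈ W ∧
      ∀ z, v (m, z) = (m, ρ z) := by
    by_contra! h
    choose ρ hρ using h
    obtain ⟨n, hn⟩ := hc (Equiv.prodShear (Equiv.refl ℕ) ρ)
    obtain ⟨z, hz⟩ := hρ n _ hn
    exact hz rfl
  obtain ⟨m, hm⟩ := key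
  refine ⟨m, fun ρ => ?_⟩
  obtain ⟨v, hv, hv'⟩ := hm ρ
  obtain ⟨w, hw, hw'⟩ := hm 1
  refine ⟨w⁻¹ * v, hW.inv_mul_mem hw hv, fun z => ?_⟩
  rw [Equiv.Perm.mul_apply, hv', Equiv.Perm.inv_eq_iff_eq, hw', Equiv.Perm.one_apply]

/-- The permutation of `ℤ × ℕ` shifting the `n`-th column by `d n`. -/
def columnShift (d : ℕ → ℤ) : Equiv.Perm (ℤ × ℕ) where
  toFun x := (x.1 + d x.2, x.2)
  invFun x := (x.1 - d x.2, x.2)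
  left_inv x := by simp
  right_inv x := by simp

/-- The permutation of `ℤ × ℕ` applying `κ` in every row of nonnegative index. -/
def upperRows (κ : Equiv.Perm ℕ) : Equiv.Perm (ℤ × ℕ) where
  toFun x := (x.1, if 0 ≤ x.1 then κ x.2 else x.2)
  invFun x := (x.1, if 0 ≤ x.1 then κ.symm x.2 else x.2)
  left_inv x := by by_cases h : 0 ≤ x.1 <;> simp [h]
  right_inv x := by by_cases h : 0 ≤ x.1 <;> simp [h]

/-- Conjugating by the shift moves the action of `κ⁻¹` from the rows `≥ 0` to the rows `≥ 1`, so
everything cancels except on row `0`. The shift is arbitrary on columns fixed by `κ`. -/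
theorem commutator_upperRows {d : ℕ → ℤ} {κ : Equiv.Perm ℕ} (hκ : ∀ n, d n ≠ 1 → κ n = n)
    (x : ℤ × ℕ) : (upperRows κ * columnShift d * (upperRows κ)⁻¹ * (columnShift d)⁻¹) x =
      (x.1, if x.1 = 0 then κ x.2 else x.2) := by
  obtain ⟨k, n⟩ := x
  have hκ' : ∀ n, d n ≠ 1 → κ.symm n = n := fun n hn => by
    rw [Equiv.symm_apply_eq, hκ n hn]
  have hd : ∀ n, d n = 1 → d (κ.symm n) = 1 := fun n hn => by
    by_contra h
    have := hκ _ h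
    rw [Equiv.apply_symm_apply] at this
    exact h (this ▸ hn)
  change (_, _) = (_, _)
  by_cases hn : d n = 1
  · have := hd n hn
    simp only [Equiv.Perm.inv_def, columnShift, upperRows, Equiv.coe_fn_mk, Equiv.coe_fn_symm_mk, hn]
    rcases lt_trichotomy k 0 with h | rfl | h
    · have h1 : ¬ (1 ≤ k) := by omega
      have h2 : ¬ (0 ≤ k) := by omega
      simp [h1, h2, hn, h.ne]
    · simp [hn]
    · have h1 : 1 ≤ k := by omega
      have h2 : 0 ≤ k := by omega
      simp [h1, h2, this, h.ne']
  · have e1 := hκ n hn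
    have e2 := hκ' n hn
    simp only [Equiv.Perm.inv_def, columnShift, upperRows, Equiv.coe_fn_mk, Equiv.coe_fn_symm_mk]
    simp [e1, e2]

/-- Every permutation supported on suitable columns of row `0` of a full slice is a commutator of
two elements of `W ^ 2`. The factors of `ℕ × ℤ × ℕ` index slices, rows and columns. -/
theorem exists_infinite_supported_subset {W : Set (Equiv.Perm (ℕ × ℤ × ℕ))} (hW : IsSyndetic W) :
    ∃ B : Set (ℕ × ℤ × ℕ), B.Infinite ∧ Bᶜ.Infinite ∧
      (permSupportedOn B : Set (Equiv.Perm (ℕ × ℤ × ℕ))) ⊆ W ^ 8 := by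
  classical
  obtain ⟨m, hm⟩ := hW.exists_full
  obtain ⟨I, hI, hI'⟩ := exists_almost_disjoint ℕ
  let d : Set ℕ → ℕ → ℤ := fun s n => if n ∈ I s then 1 else 0
  obtain ⟨s, u, hsu, hmem⟩ := hW.exists_ne_inv_mul_mem
    fun s => Equiv.Perm.prodExtendRight m (columnShift (d s))
  set h := (Equiv.Perm.prodExtendRight m (columnShift (d s)))⁻¹ *
    Equiv.Perm.prodExtendRight m (columnShift (d u)) with hdef
  have h_m : ∀ z, h (m, z) = (m, columnShift (fun n => d u n - d s n) z) := fun z => by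
    rw [hdef, Equiv.Perm.mul_apply, Equiv.Perm.prodExtendRight_apply_eq, Equiv.Perm.inv_eq_iff_eq,
      Equiv.Perm.prodExtendRight_apply_eq]
    simp only [columnShift, Equiv.coe_fn_mk]
    congr 2
    ring
  have h_ne : ∀ i z, i ≠ m → h (i, z) = (i, z) := fun i z hi => by
    rw [hdef, Equiv.Perm.mul_apply, Equiv.Perm.prodExtendRight_apply_ne _ hi,
      Equiv.Perm.inv_eq_iff_eq, Equiv.Perm.prodExtendRight_apply_ne _ hi]
  set N : Set ℕ := I u \ I s with hN
  have hNinf : N.Infinite := by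
    have := (hI u).sdiff (hI' u s hsu.symm)
    rwa [sdiff_self_inter] at this
  refine ⟨(fun n => (m, 0, n)) '' N, hNinf.image (by intro a _ b _; simp), ?_, ?_⟩
  · refine (infinite_range_of_injective (f := fun n : ℕ => (m, (1 : ℤ), n)) ?_).mono ?_
    · intro a b; simp
    · rintro _ ⟨n, rfl⟩; simp
  · intro σ hσ
    have hsupp := mem_permSupportedOn.1 hσ
    have main : ∀ τ ∈ permSupportedOn ((fun n => (m, (0 : ℤ), n)) '' N), ∀ n,
        τ (m, 0, n) = (m, 0, (τ (m, 0, n)).2.2) := by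
      intro τ hτ n
      by_cases hB : τ (m, 0, n) ∈ (fun n => (m, (0 : ℤ), n)) '' N
      · obtain ⟨k, -, hk⟩ := hB
        rw [← hk]
      · have := mem_permSupportedOn.1 hτ _ hB
        rw [τ.injective this]
    let κ : Equiv.Perm ℕ :=
      { toFun := fun n => (σ (m, 0, n)).2.2
        invFun := fun n => (σ⁻¹ (m, 0, n)).2.2
        left_inv := fun n => by
          change (σ⁻¹ (m, 0, (σ (m, 0, n)).2.2)).2.2 = n
          rw [← main σ hσ n, ← Equiv.Perm.mul_apply, inv_mul_cancel, Equiv.Perm.one_apply]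
        right_inv := fun n => by
          change (σ (m, 0, (σ⁻¹ (m, 0, n)).2.2)).2.2 = n
          rw [← main _ (inv_mem hσ) n, ← Equiv.Perm.mul_apply, mul_inv_cancel, Equiv.Perm.one_apply] }
    have hκ : ∀ n, d u n - d s n ≠ 1 → κ n = n := by
      intro n hn
      change (σ (m, 0, n)).2.2 = n
      rw [hsupp]
      rintro ⟨k, hk, hk'⟩
      simp only [Prod.mk.injEq, true_and] at hk'
      subst hk'
      apply hn
      simp [d, hk.1, hk.2]
    obtain ⟨v, hv, hvm⟩ := hm (upperRows κ)
    have hv_inv : ∀ z, v⁻¹ (m, z) = (m, (upperRows κ)⁻¹ z) := fun z => by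
      rw [Equiv.Perm.inv_eq_iff_eq, hvm, ← Equiv.Perm.mul_apply, mul_inv_cancel, Equiv.Perm.one_apply]
    have h_inv : ∀ z, h⁻¹ (m, z) = (m, (columnShift fun n => d u n - d s n)⁻¹ z) := fun z => by
      rw [Equiv.Perm.inv_eq_iff_eq, h_m, ← Equiv.Perm.mul_apply, mul_inv_cancel, Equiv.Perm.one_apply]
    have h_inv_ne : ∀ i z, i ≠ m → h⁻¹ (i, z) = (i, z) := fun i z hi => by
      rw [Equiv.Perm.inv_eq_iff_eq, h_ne i z hi]
    -- The unknown action of `v` off slice `m` is harmless: `h` is trivial there, so `v` cancels.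
    have : σ = v * h * v⁻¹ * h⁻¹ := by
      ext1 ⟨i, z⟩
      by_cases hi : i = m
      · subst hi
        have := commutator_upperRows hκ z
        simp only [Equiv.Perm.mul_apply] at this ⊢
        rw [h_inv, hv_inv, h_m, hvm, this]
        obtain ⟨k, n⟩ := z
        by_cases hk : k = 0
        · subst hk
          rw [if_pos rfl]
          exact main σ hσ n
        · rw [if_neg hk, hsupp]
          rintro ⟨_, -, h⟩
          simp only [Prod.mk.injEq, true_and] at h
          exact hk h.1.symm
      · have hvi : (v⁻¹ (i, z)).1 ≠ m := fun h' => hi <| by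
          have e : v⁻¹ (i, z) = (m, (v⁻¹ (i, z)).2) := by rw [← h']
          rw [Equiv.Perm.inv_eq_iff_eq, hvm] at e
          exact congrArg Prod.fst e
        simp only [Equiv.Perm.mul_apply]
        rw [h_inv_ne i z hi, show v⁻¹ (i, z) = ((v⁻¹ (i, z)).1, (v⁻¹ (i, z)).2) from rfl,
          h_ne _ _ hvi, Prod.mk.eta, ← Equiv.Perm.mul_apply, mul_inv_cancel, Equiv.Perm.one_apply, hsupp]
        rintro ⟨_, -, h'⟩
        exact hi (congrArg Prod.fst h').symm
    rw [this]
    exact mul_mem_pow (mul_mem_pow (mul_mem_pow hv hmem) (hW.inv_mem_pow hv)) (hW.inv_mem_pow hmem)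

/-- The Steinhaus property of the symmetric group, for the topology of pointwise convergence. -/
theorem exists_finite_stabilizer_subset {W : Set (Equiv.Perm (ℕ × ℤ × ℕ))} (hW : IsSyndetic W) :
    ∃ F : Set (ℕ × ℤ × ℕ), F.Finite ∧ ∀ σ : Equiv.Perm (ℕ × ℤ × ℕ), (∀ x ∈ F, σ x = x) →
      σ ∈ W ^ 32 ∨ σ ∈ W ^ 28 := by
  obtain ⟨B, hB, hB', hBW⟩ := hW.exists_infinite_supported_subset
  obtain ⟨I, hI, hI'⟩ := exists_almost_disjoint (ℕ × ℤ × ℕ)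
  have hIc : ∀ s, (I s)ᶜ.Infinite := fun s =>
    (exists_third hI hI' s s).mono (compl_subset_compl.2 subset_union_left)
  -- With complements of almost disjoint sets as images, `B` and its translate by `h` have cofinite
  -- union and infinite intersection.
  have hg : ∀ s, ∃ g : Equiv.Perm (ℕ × ℤ × ℕ), g '' B = (I s)ᶜ := fun s => by
    obtain ⟨f, hf⟩ := exists_bijOn hB (hIc s)
    obtain ⟨g, hg, -⟩ := exists_perm_extend (subset_univ B) (mapsTo_univ f B) hf.injOn
      (by rwa [← compl_eq_univ_sdiff]) (by rw [← compl_eq_univ_sdiff, hf.image_eq, compl_compl]; exact hI s)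
    exact ⟨g, by rw [← hf.image_eq]; exact image_congr hg⟩
  choose g hg using hg
  obtain ⟨s, u, hsu, hmem⟩ := hW.exists_ne_inv_mul_mem g
  set h := (g s)⁻¹ * g u with hdef
  have hhB : h '' B = (g s).symm '' (I u)ᶜ := by
    rw [hdef, ← hg u, ← image_comp]
    rfl
  have hB2 : B = (g s).symm '' (I s)ᶜ := by
    rw [← hg s, Equiv.symm_image_image]
  have hinter : (B ∩ h '' B).Infinite := by
    rw [hhB]
    nth_rw 1 [hB2]
    rw [← image_inter (g s).symm.injective, ← compl_union]
    exact (exists_third hI hI' s u).image (g s).symm.injective.injOn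
  have hunion : (B ∪ h '' B)ᶜ.Finite := by
    rw [hhB]
    nth_rw 1 [hB2]
    rw [← image_union, ← compl_inter, image_compl_eq (g s).symm.bijective, compl_compl]
    exact (hI' s u hsu).image _
  have hhS : ∀ σ ∈ permSupportedOn (h '' B), σ ∈ W ^ 12 := fun σ hσ => by
    have : h⁻¹ * σ * h ∈ permSupportedOn B := by
      rw [mem_permSupportedOn] at hσ ⊢
      intro x hx
      rw [Equiv.Perm.mul_apply, Equiv.Perm.mul_apply, Equiv.Perm.inv_eq_iff_eq, hσ]
      rintro ⟨y, hy, hyx⟩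
      rw [h.injective hyx] at hy
      exact hx hy
    have := mul_mem_pow (mul_mem_pow hmem (hBW this)) (hW.inv_mem_pow hmem)
    rwa [show h * (h⁻¹ * σ * h) * h⁻¹ = σ by group] at this
  refine ⟨_, hunion, fun σ hσ => ?_⟩
  -- The exponents are `8 + 12 + 8` or `12 + 8 + 12`, where `12 = 2 + 8 + 2` comes from conjugating
  -- by `h`.
  rcases mem_mul_of_mem_union (mem_permSupportedOn.2 hσ) hinter with
    ⟨a, ha, b, hb, c, hc, rfl⟩ | ⟨a, ha, b, hb, c, hc, rfl⟩
  · exact .inr (mul_mem_pow (mul_mem_pow (hBW ha) (hhS b hb)) (hBW hc))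
  · exact .inl (mul_mem_pow (mul_mem_pow (hhS a ha) (hBW hb)) (hhS c hc))

end IsSyndetic

/-! ### The pointwise topologies on the symmetric inverse monoid -/

namespace SymInv

variable {X : Type*}

theorem mul_apply (f g : SymInv X) (x : X) : (f * g) x = (f x).bind g := rfl

theorem inv_def (f : SymInv X) : f⁻¹ = f.symm := rfl

theorem inv_apply_eq_some {f : SymInv X} {x y : X} : f⁻¹ y = some x ↔ f x = some y :=
  PEquiv.eq_some_iff f

theorem mul_eq_some {f g : SymInv X} {x y : X} :
    (f * g) x = some y ↔ ∃ z, f x = some z ∧ g z = some y := by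
  rw [mul_apply, Option.bind_eq_some_iff]

theorem ext_some {f g : SymInv X} (h : ∀ x y, f x = some y ↔ g x = some y) : f = g :=
  PEquiv.ext fun x => Option.ext fun y => h x y

theorem inv_mul_rev (f g : SymInv X) : (f * g)⁻¹ = g⁻¹ * f⁻¹ :=
  PEquiv.symm_trans_rev f g

theorem continuous_CPT {Y : Type*} {t : TopologicalSpace Y} {g : Y → SymInv X} :
    Continuous[t, CPT X] g ↔ (∀ x y, IsOpen[t] {z | g z x = some y}) ∧
      ∀ x y, IsOpen[t] {z | g z x ≠ some y} := by
  rw [CPT, continuous_generateFrom_iff]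
  constructor
  · exact fun h => ⟨fun x y => h _ (.inl ⟨x, y, rfl⟩), fun x y => h _ (.inr ⟨x, y, rfl⟩)⟩
  · rintro ⟨h1, h2⟩ _ (⟨x, y, rfl⟩ | ⟨x, y, rfl⟩)
    exacts [h1 x y, h2 x y]

theorem continuous_PPT {Y : Type*} {t : TopologicalSpace Y} {g : Y → X → Option X} :
    Continuous[t, PPT X] g ↔ ∀ x c, IsOpen[t] {z | g z x = c} := by
  rw [PPT, continuous_generateFrom_iff]
  constructor
  · rintro h x (_ | y)
    exacts [h _ (.inr ⟨x, rfl⟩), h _ (.inl ⟨x, y, rfl⟩)]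
  · rintro h _ (⟨x, y, rfl⟩ | ⟨x, rfl⟩)
    exacts [h x _, h x _]

theorem continuous_LPT {Y : Type*} {t : TopologicalSpace Y} {g : Y → SymInv X} :
    Continuous[t, LPT X] g ↔ ∀ x c, IsOpen[t] {z | g z x = c} := by
  rw [LPT, continuous_induced_rng]
  exact continuous_PPT

theorem continuous_RPT {Y : Type*} {t : TopologicalSpace Y} {g : Y → SymInv X} :
    Continuous[t, RPT X] g ↔ ∀ x c, IsOpen[t] {z | (g z)⁻¹ x = c} := by
  rw [RPT, continuous_induced_rng]
  exact continuous_LPT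

theorem IPT_eq (X : Type*) : IPT X = LPT X ⊓ RPT X := by
  rw [IPT, openFamily, openFamily, generateFrom_union,
    TopologicalSpace.generateFrom_setOfPred_isOpen, TopologicalSpace.generateFrom_setOfPred_isOpen]

theorem continuous_IPT {Y : Type*} {t : TopologicalSpace Y} {g : Y → SymInv X} :
    Continuous[t, IPT X] g ↔ (∀ x c, IsOpen[t] {z | g z x = c}) ∧
      ∀ x c, IsOpen[t] {z | (g z)⁻¹ x = c} := by
  rw [IPT_eq, continuous_inf_rng, continuous_LPT, continuous_RPT]

theorem isOpen_CPT_some (x y : X) : IsOpen[CPT X] {f | f x = some y} :=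
  (continuous_CPT.1 (@continuous_id _ (CPT X))).1 x y

theorem isOpen_CPT_ne (x y : X) : IsOpen[CPT X] {f | f x ≠ some y} :=
  (continuous_CPT.1 (@continuous_id _ (CPT X))).2 x y

theorem isOpen_LPT (x : X) (c : Option X) : IsOpen[LPT X] {f | f x = c} :=
  continuous_LPT.1 (@continuous_id _ (LPT X)) x c

theorem isOpen_RPT (x : X) (c : Option X) : IsOpen[RPT X] {f | f⁻¹ x = c} :=
  continuous_RPT.1 (@continuous_id _ (RPT X)) x c

theorem isOpen_IPT (x : X) (c : Option X) : IsOpen[IPT X] {f | f x = c} :=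
  (continuous_IPT.1 (@continuous_id _ (IPT X))).1 x c

theorem isOpen_IPT_inv (x : X) (c : Option X) : IsOpen[IPT X] {f | f⁻¹ x = c} :=
  (continuous_IPT.1 (@continuous_id _ (IPT X))).2 x c

theorem le_LPT {t : TopologicalSpace (SymInv X)} (h : ∀ x c, IsOpen[t] {f : SymInv X | f x = c}) :
    t ≤ LPT X :=
  continuous_id_iff_le.1 (continuous_LPT.2 h)

theorem le_RPT {t : TopologicalSpace (SymInv X)}
    (h : ∀ x c, IsOpen[t] {f : SymInv X | f⁻¹ x = c}) : t ≤ RPT X :=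
  continuous_id_iff_le.1 (continuous_RPT.2 h)

theorem LPT_le_CPT (X : Type*) : LPT X ≤ CPT X := by
  refine continuous_id_iff_le.1 (continuous_CPT.2 ⟨fun x y => isOpen_LPT x _, fun x y => ?_⟩)
  have : {f : SymInv X | id f x ≠ some y} = ⋃ c ∈ {c | c ≠ some y}, {f | f x = c} := by
    ext f; simp
  rw [this]
  exact @isOpen_biUnion _ _ (LPT X) _ _ fun c _ => isOpen_LPT x c

theorem RPT_le_CPT (X : Type*) : RPT X ≤ CPT X := by
  refine continuous_id_iff_le.1 (continuous_CPT.2 ⟨fun x y => ?_, fun x y => ?_⟩)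
  · simpa only [id, inv_apply_eq_some] using isOpen_RPT y (some x)
  · have : {f : SymInv X | id f x ≠ some y} = ⋃ c ∈ {c | c ≠ some x}, {f | f⁻¹ y = c} := by
      ext f; simp [← inv_apply_eq_some (f := f)]
    rw [this]
    exact @isOpen_biUnion _ _ (RPT X) _ _ fun c _ => isOpen_RPT y c

theorem t2Space_CPT (X : Type*) : @T2Space (SymInv X) (CPT X) := by
  let := CPT X
  refine ⟨fun f g hfg => ?_⟩
  obtain ⟨x, y, h⟩ : ∃ x y, ¬ (f x = some y ↔ g x = some y) := by
    by_contra! h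
    exact hfg (ext_some h)
  by_cases hf : f x = some y
  · exact ⟨_, _, isOpen_CPT_some x y, isOpen_CPT_ne x y, hf, fun hg => h (by tauto),
      Set.disjoint_left.2 fun k h1 h2 => h2 h1⟩
  · exact ⟨_, _, isOpen_CPT_ne x y, isOpen_CPT_some x y, hf, by simp only [mem_ofPred_eq]; tauto,
      Set.disjoint_left.2 fun k h1 h2 => h1 h2⟩

theorem t2Space_of_le_CPT {t : TopologicalSpace (SymInv X)} (h : t ≤ CPT X) : @T2Space _ t :=
  t2Space_antitone h (t2Space_CPT X)

theorem continuousMul_LPT (X : Type*) : @ContinuousMul (SymInv X) (LPT X) _ := by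
  let := LPT X
  refine @ContinuousMul.mk _ (LPT X) _ (continuous_LPT.2 fun x c => ?_)
  have : {z : SymInv X × SymInv X | (z.1 * z.2) x = c} =
      ⋃ d : Option X, {z : SymInv X × SymInv X | z.1 x = d} ∩ {z | d.bind z.2 = c} := by
    ext z; simp [mul_apply]
  have h1 : ∀ d, IsOpen {z : SymInv X × SymInv X | z.1 x = d} := fun d =>
    (isOpen_LPT x d).preimage continuous_fst
  rw [this]
  refine isOpen_iUnion fun d => (h1 d).inter ?_
  cases d with
  | none => exact isOpen_const (p := none = c)
  | some y => exact (isOpen_LPT y c).preimage continuous_snd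

/-- Inversion is a homomorphism into the opposite semigroup, whose multiplication is continuous as
well. -/
theorem compatible_induced_inv {t : TopologicalSpace (SymInv X)}
    (ht : @ContinuousMul (SymInv X) t _) :
    @ContinuousMul (SymInv X) (t.induced fun f => f⁻¹) _ := by
  let := t
  have : ContinuousMul (SymInv X) := ht
  let j : SymInv X →ₙ* (SymInv X)ᵐᵒᵖ :=
    { toFun := fun f => MulOpposite.op f⁻¹
      map_mul' := fun f g => by rw [inv_mul_rev, MulOpposite.op_mul] }
  have h := continuousMul_induced j
  rwa [show TopologicalSpace.induced j inferInstance = t.induced fun f => f⁻¹ from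
    induced_compose] at h

theorem continuousMul_RPT (X : Type*) : @ContinuousMul (SymInv X) (RPT X) _ :=
  compatible_induced_inv (continuousMul_LPT X)

theorem continuousMul_IPT (X : Type*) : @ContinuousMul (SymInv X) (IPT X) _ := by
  rw [IPT_eq]
  exact @continuousMul_inf _ _ _ _ (continuousMul_LPT X) (continuousMul_RPT X)

theorem continuousInv_IPT (X : Type*) : @ContinuousInv (SymInv X) (IPT X) _ := by
  let := IPT X
  refine ⟨continuous_IPT.2 ⟨isOpen_IPT_inv, fun x c => ?_⟩⟩
  simpa only [inv_inv] using isOpen_IPT x c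

theorem IPT_le_LPT (X : Type*) : IPT X ≤ LPT X := IPT_eq X ▸ inf_le_left

/-- `f ↦ (f, f⁻¹)` embeds the space in a countable product of countable discrete spaces; its image
is closed, being cut out by conditions on two coordinates each. -/
theorem polishSpace_IPT (X : Type*) [Countable X] : @PolishSpace (SymInv X) (IPT X) := by
  let := IPT X
  let : TopologicalSpace (Option X) := ⊥
  have : DiscreteTopology (Option X) := ⟨rfl⟩
  have happ : ∀ x, Continuous fun f : SymInv X => f x := fun x =>
    continuous_discrete_rng.2 fun c => isOpen_IPT x c
  have happ' : ∀ x, Continuous fun f : SymInv X => f⁻¹ x := fun x =>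
    continuous_discrete_rng.2 fun c => isOpen_IPT_inv x c
  let j : SymInv X → (X → Option X) × (X → Option X) := fun f => (f, ⇑f⁻¹)
  have hj : Continuous j := (continuous_pi happ).prodMk (continuous_pi happ')
  have hfst : ∀ x, Continuous fun p : (X → Option X) × (X → Option X) => p.1 x := by fun_prop
  have hsnd : ∀ x, Continuous fun p : (X → Option X) × (X → Option X) => p.2 x := by fun_prop
  have hind : IsInducing j := by
    refine ⟨le_antisymm hj.le_induced ?_⟩
    refine continuous_id_iff_le.1 (continuous_IPT.2 ⟨fun x c => ?_, fun x c => ?_⟩)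
    · exact isOpen_induced_iff.2 ⟨{p | p.1 x = c}, (isOpen_discrete {c}).preimage (hfst x), rfl⟩
    · exact isOpen_induced_iff.2 ⟨{p | p.2 x = c}, (isOpen_discrete {c}).preimage (hsnd x), rfl⟩
  have hinj : Function.Injective j := fun f g h => DFunLike.coe_injective (congrArg Prod.fst h)
  have hrange : Set.range j =
      ⋂ x, ⋂ y, {p : (X → Option X) × (X → Option X) | (p.1 x, p.2 y) ∈
        {q : Option X × Option X | q.1 = some y ↔ q.2 = some x}} := by
    ext p
    simp only [mem_iInter, mem_ofPred_eq, mem_range]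
    constructor
    · rintro ⟨f, rfl⟩ x y
      exact inv_apply_eq_some.symm
    · intro h
      exact ⟨⟨p.1, p.2, fun a b => (h a b).symm⟩, rfl⟩
  have : TopologicalSpace.IsCompletelyMetrizableSpace (X → Option X) := inferInstance
  have : SecondCountableTopology (X → Option X) := inferInstance
  have : PolishSpace ((X → Option X) × (X → Option X)) := {}
  refine IsClosedEmbedding.polishSpace (f := j) ⟨⟨hind, hinj⟩, ?_⟩
  rw [hrange]
  refine isClosed_iInter fun x => isClosed_iInter fun y => ?_
  exact (isClosed_discrete _).preimage ((hfst x).prodMk (hsnd y))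

/-! ### Lower bounds for Fréchet topologies: `CPT` and `IPT` -/

/-- The identity on a singleton. -/
noncomputable def point (x : X) : SymInv X := by
  classical exact PEquiv.single x x

theorem point_eq_some {x a b : X} : point x a = some b ↔ a = x ∧ b = x := by
  classical
  exact PEquiv.mem_single_iff a x b x

theorem point_mul_mul_point {f : SymInv X} {x y a b : X} :
    (point x * f * point y) a = some b ↔ a = x ∧ b = y ∧ f x = some y := by
  simp only [mul_eq_some, point_eq_some]
  grind

theorem semicompatible_CPT (X : Type*) : SemigroupTopology.Semicompatible (SymInv X) (CPT X) := by
  have key : ∀ g : SymInv X, Continuous[CPT X, CPT X] fun f => g * f := fun g => by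
    let := CPT X
    refine continuous_CPT.2 ⟨fun x y => ?_, fun x y => ?_⟩
    · simp only [mul_apply]
      cases g x with
      | none => exact isOpen_const (p := none = some y)
      | some z => exact isOpen_CPT_some z y
    · simp only [mul_apply]
      cases g x with
      | none => exact isOpen_const (p := none ≠ some y)
      | some z => exact isOpen_CPT_ne z y
  have hinv : Continuous[CPT X, CPT X] fun f => f⁻¹ := by
    refine continuous_CPT.2 ⟨fun x y => ?_, fun x y => ?_⟩
    · simpa only [inv_apply_eq_some] using isOpen_CPT_some y x
    · simpa only [ne_eq, inv_apply_eq_some] using isOpen_CPT_ne y x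
  let := CPT X
  refine @SeparatelyContinuousMul.mk _ (CPT X) _ (fun {g} => key g) (fun {g} => ?_)
  -- Inversion is continuous for `CPT`, so right translations reduce to left ones.
  have : (fun f : SymInv X => f * g) = fun f => (g⁻¹ * f⁻¹)⁻¹ := by
    funext f
    rw [inv_mul_rev, inv_inv, inv_inv]
  rw [this]
  exact hinv.comp ((key _).comp hinv)

/-- The continuous map `f ↦ point x * f * point y` takes only two values, and each is a closed
singleton; the two subbasic sets are the preimages of their complements. -/
theorem le_CPT {t : TopologicalSpace (SymInv X)} (h1 : @T1Space _ t)
    (h : SemigroupTopology.Semicompatible (SymInv X) t) : t ≤ CPT X := by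
  let := t
  have : SeparatelyContinuousMul (SymInv X) := h
  have hc : ∀ x y, Continuous fun f : SymInv X => point x * f * point y := fun x y =>
    (continuous_mul_const _).comp (continuous_const_mul _)
  have key : ∀ (x y) (f g : SymInv X), (f x = some y ↔ g x = some y) →
      point x * f * point y = point x * g * point y := fun x y f g h => by
    refine ext_some fun a b => ?_
    rw [point_mul_mul_point, point_mul_mul_point, h]
  have key' : ∀ (x y) (f g : SymInv X), point x * f * point y = point x * g * point y →
      (f x = some y ↔ g x = some y) := fun x y f g h => by
    have e1 := point_mul_mul_point (f := f) (x := x) (y := y) (a := x) (b := y)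
    have e2 := point_mul_mul_point (f := g) (x := x) (y := y) (a := x) (b := y)
    rw [h] at e1
    tauto
  classical
  refine continuous_id_iff_le.1 (continuous_CPT.2 ⟨fun x y => ?_, fun x y => ?_⟩)
  · convert (isOpen_compl_singleton (x := point x * ⊥ * point y)).preimage (hc x y) using 1
    ext f
    have h1 := key x y f ⊥
    have h2 := key' x y f ⊥
    simp only [PEquiv.bot_apply, reduceCtorEq, iff_false] at h1 h2
    simp only [id, mem_ofPred_eq, mem_preimage, mem_compl_iff, mem_singleton_iff]
    tauto
  · convert (isOpen_compl_singleton (x := point x * PEquiv.single x y * point y)).preimage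
      (hc x y) using 1
    ext f
    have h1 := key x y f (PEquiv.single x y)
    have h2 := key' x y f (PEquiv.single x y)
    simp only [PEquiv.single_apply, iff_true] at h1 h2
    simp only [id, mem_ofPred_eq, mem_preimage, mem_compl_iff, mem_singleton_iff]
    tauto

theorem Compatible.semicompatible {S : Type*} [Semigroup S] {t : TopologicalSpace S}
    (h : SemigroupTopology.Compatible S t) : SemigroupTopology.Semicompatible S t := by
  let := t
  have : ContinuousMul S := h
  exact (inferInstance : SeparatelyContinuousMul S)

/-- Every compatible Fréchet topology on the symmetric inverse monoid refines `IPT`. -/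
theorem le_IPT {t : TopologicalSpace (SymInv X)} (h1 : @T1Space _ t)
    (h : InverseSemigroupTopology.Compatible (SymInv X) t) : t ≤ IPT X := by
  let := t
  have : ContinuousMul (SymInv X) := h.1
  have : ContinuousInv (SymInv X) := h.2
  have hC : t ≤ CPT X := le_CPT h1 (Compatible.semicompatible h.1)
  have hL : ∀ x c, IsOpen {f : SymInv X | f x = c} := fun x c => by
    cases c with
    | some y => exact hC _ (isOpen_CPT_some x y)
    | none =>
      have hc : Continuous fun f : SymInv X => f * f⁻¹ := continuous_id.mul continuous_inv
      -- `f * f⁻¹` is the identity on the domain of `f`, so `x` is outside the domain iff `(x, x)`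
      -- is not in it.
      convert (hC _ (isOpen_CPT_ne x x)).preimage hc using 1
      ext f
      simp only [mem_ofPred_eq, mem_preimage, ne_eq, mul_eq_some, inv_apply_eq_some, and_self]
      simp [Option.eq_none_iff_forall_ne_some]
  rw [IPT_eq]
  exact le_inf (le_LPT hL) (le_RPT fun x c => (hL x c).preimage continuous_inv)

end SymInv

/-! ### Automatic continuity for the symmetric group -/

section AutomaticContinuity

variable {T : Type*} [Semigroup T] [TopologicalSpace T] [ContinuousMul T]

/-- `ψ 1` is idempotent, so continuity of multiplication at `(ψ 1, ψ 1)` can be iterated, doubling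
the exponent each time. -/
theorem exists_open_preimage_pow_subset {G : Type*} [Group G] (ψ : G →ₙ* T) {U : Set T}
    (hU : IsOpen U) (h1 : ψ 1 ∈ U) (k : ℕ) :
    ∃ V : Set T, IsOpen V ∧ ψ 1 ∈ V ∧ (ψ ⁻¹' V) ^ 2 ^ k ⊆ ψ ⁻¹' U := by
  induction k with
  | zero => exact ⟨U, hU, h1, by simp⟩
  | succ k ih =>
    obtain ⟨V, hV, hV1, hVU⟩ := ih
    have hmem : V ∈ 𝓝 (ψ 1 * ψ 1) := by
      rw [← map_mul, mul_one]
      exact hV.mem_nhds hV1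
    obtain ⟨A, B, hA, hA1, hB, hB1, hAB⟩ :=
      mem_nhds_prod_iff'.1 (continuous_mul.continuousAt (x := (ψ 1, ψ 1)) hmem)
    refine ⟨A ∩ B, hA.inter hB, ⟨hA1, hB1⟩, ?_⟩
    rw [pow_succ', pow_mul]
    refine (Set.pow_subset_pow_left ?_).trans hVU
    rw [pow_two]
    rintro _ ⟨x, hx, y, hy, rfl⟩
    simp only [mem_preimage, map_mul]
    exact hAB (show (ψ x, ψ y) ∈ A ×ˢ B from ⟨hx.1, hy.2⟩)

/-- Since `T` has no inversion, `G` gets the topology induced by `g ↦ (ψ g, ψ g⁻¹)`. It is second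
countable and the left translates of the set are neighbourhoods of the translating elements, so
countably many cover `G`. -/
theorem isSyndetic_preimage [SecondCountableTopology T] {G : Type*} [Group G] (ψ : G →ₙ* T)
    {V : Set T} (hV : IsOpen V) (h1 : ψ 1 ∈ V) : IsSyndetic (ψ ⁻¹' V ∩ (ψ ⁻¹' V)⁻¹) := by
  refine ⟨by rw [Set.inter_inv, inv_inv, inter_comm], ?_⟩
  let j : G → T × T := fun g => (ψ g, ψ g⁻¹)
  let : TopologicalSpace G := TopologicalSpace.induced j inferInstance
  have : SecondCountableTopology G := TopologicalSpace.secondCountableTopology_induced G (T × T) j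
  have hj : Continuous j := continuous_induced_dom
  have hj1 : Continuous ψ := continuous_fst.comp hj
  have hj2 : Continuous fun g => ψ g⁻¹ := continuous_snd.comp hj
  have hnhds : ∀ g : G, {h | g⁻¹ * h ∈ ψ ⁻¹' V ∩ (ψ ⁻¹' V)⁻¹} ∈ 𝓝 g := fun g => by
    have hopen : IsOpen {h | g⁻¹ * h ∈ ψ ⁻¹' V ∩ (ψ ⁻¹' V)⁻¹} := by
      have e : {h | g⁻¹ * h ∈ ψ ⁻¹' V ∩ (ψ ⁻¹' V)⁻¹} =
          (fun h => ψ g⁻¹ * ψ h) ⁻¹' V ∩ (fun h => ψ h⁻¹ * ψ g) ⁻¹' V := by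
        ext h
        simp [← map_mul]
      rw [e]
      exact (hV.preimage (continuous_const.mul hj1)).inter (hV.preimage (hj2.mul continuous_const))
    exact hopen.mem_nhds (by simpa [-map_mul] using h1)
  obtain ⟨s, hs, hcover⟩ := TopologicalSpace.countable_cover_nhds hnhds
  have hne : s.Nonempty := by
    by_contra h
    rw [not_nonempty_iff_eq_empty] at h
    simp only [h, mem_empty_iff_false, iUnion_of_empty, iUnion_empty] at hcover
    exact Set.empty_ne_univ hcover
  obtain ⟨c, rfl⟩ := hs.exists_eq_range hne
  refine ⟨c, fun g => ?_⟩
  have : g ∈ ⋃ x ∈ range c, {h | x⁻¹ * h ∈ ψ ⁻¹' V ∩ (ψ ⁻¹' V)⁻¹} := hcover ▸ mem_univ g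
  simpa only [mem_iUnion, exists_range_iff, exists_prop, mem_ofPred_eq] using this

/-- Automatic continuity of the symmetric group on a countable set. -/
theorem exists_finite_stabilizer_preimage [SecondCountableTopology T] {α : Type*} [Countable α]
    [Infinite α] (ψ : Equiv.Perm α →ₙ* T) {U : Set T} (hU : IsOpen U) (h1 : ψ 1 ∈ U) :
    ∃ F : Set α, F.Finite ∧ ∀ σ : Equiv.Perm α, (∀ x ∈ F, σ x = x) → ψ σ ∈ U := by
  obtain ⟨e⟩ := nonempty_equiv_of_countable (α := ℕ × ℤ × ℕ) (β := α)
  let ψ' : Equiv.Perm (ℕ × ℤ × ℕ) →ₙ* T := ψ.comp (e.permCongrHom : _ →ₙ* Equiv.Perm α)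
  have h1' : ψ' 1 = ψ 1 := congrArg ψ (map_one e.permCongrHom)
  -- `2 ^ 5 = 32` is the larger exponent of the stabilizer lemma; since `1 ∈ W`, it absorbs `28`.
  obtain ⟨V, hV, hV1, hVU⟩ := exists_open_preimage_pow_subset ψ' hU (h1'.symm ▸ h1) 5
  have hW := isSyndetic_preimage ψ' hV hV1
  set W := ψ' ⁻¹' V ∩ (ψ' ⁻¹' V)⁻¹
  have hW1 : (1 : Equiv.Perm (ℕ × ℤ × ℕ)) ∈ W := ⟨hV1, by simpa using hV1⟩
  obtain ⟨F, hF, hFW⟩ := hW.exists_finite_stabilizer_subset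
  refine ⟨e '' F, hF.image e, fun σ hσ => ?_⟩
  have hmem : e.permCongrHom.symm σ ∈ W ^ 32 := by
    rcases hFW (e.permCongrHom.symm σ) (fun x hx => by
      change e.symm (σ (e x)) = x
      rw [hσ _ ⟨x, hx, rfl⟩, e.symm_apply_apply]) with h | h
    · exact h
    · exact Set.pow_subset_pow_right hW1 (by norm_num) h
  have := hVU (Set.pow_subset_pow_left inter_subset_left hmem)
  change ψ (e.permCongrHom (e.permCongrHom.symm σ)) ∈ U at this
  rwa [MulEquiv.apply_symm_apply] at this

end AutomaticContinuity

/-! ### Transfer to the monoid by dilation -/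

namespace SymInv

variable {X : Type*}

/-- The underlying function of the unitary dilation of a partial bijection. -/
def dilationFun (s : SymInv X) : X ⊕ X → X ⊕ X
  | .inl x => (s x).elim (.inr x) .inl
  | .inr y => (s⁻¹ y).elim (.inl y) .inr

theorem dilationFun_inv (s : SymInv X) (z : X ⊕ X) : dilationFun s⁻¹ (dilationFun s z) = z := by
  rcases z with x | y
  · cases h : s x with
    | none => simp [dilationFun, h]
    | some y => simp [dilationFun, h, inv_apply_eq_some.2 h]
  · cases h : s⁻¹ y with
    | none => simp [dilationFun, h]
    | some x => simp [dilationFun, h, inv_apply_eq_some.1 h]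

/-- A permutation of `X ⊕ X` whose compression to the first summand is the given partial
bijection. -/
def dilation (s : SymInv X) : Equiv.Perm (X ⊕ X) where
  toFun := dilationFun s
  invFun := dilationFun s⁻¹
  left_inv := dilationFun_inv s
  right_inv z := by simpa using dilationFun_inv s⁻¹ z

/-- The inclusion of the first summand, as a partial bijection of `X ≃ X ⊕ X`. -/
def inclusion (k : X ⊕ X ≃ X) : SymInv X where
  toFun x := some (k (.inl x))
  invFun y := (k.symm y).getLeft?
  inv x y := by
    rw [Sum.getLeft?_eq_some_iff, Equiv.symm_apply_eq, Option.some_inj, eq_comm]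

/-- A permutation of `X ⊕ X` as a partial bijection of `X ≃ X ⊕ X`. -/
def ofPerm (k : X ⊕ X ≃ X) (σ : Equiv.Perm (X ⊕ X)) : SymInv X :=
  ((k.symm.trans σ).trans k).toPEquiv

/-- The order is reversed because permutations compose from right to left and partial bijections
from left to right. -/
theorem ofPerm_mul (k : X ⊕ X ≃ X) (σ τ : Equiv.Perm (X ⊕ X)) :
    ofPerm k (σ * τ) = ofPerm k τ * ofPerm k σ := by
  refine PEquiv.ext fun x => ?_
  simp [ofPerm, mul_apply, Equiv.toPEquiv_apply]

theorem eq_compression (k : X ⊕ X ≃ X) (s : SymInv X) :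
    s = inclusion k * ofPerm k (dilation s) * (inclusion k)⁻¹ := by
  refine PEquiv.ext fun x => ?_
  have h : (inclusion k * ofPerm k (dilation s) * (inclusion k)⁻¹) x =
      (k.symm (k (dilation s (k.symm (k (.inl x)))))).getLeft? := rfl
  rw [h, Equiv.symm_apply_apply, Equiv.symm_apply_apply]
  change s x = (dilationFun s (.inl x)).getLeft?
  cases h : s x <;> simp [dilationFun, h]

/-- The dilation at `inl x` encodes exactly `f x`, and at `inr y` exactly `f⁻¹ y`; these are the
data that `IPT` controls. -/
theorem isOpen_agree_dilation {F : Set (X ⊕ X)} (hF : F.Finite) (s : SymInv X) :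
    IsOpen[IPT X] {f : SymInv X | ∀ z ∈ F, dilation f z = dilation s z} := by
  let := IPT X
  have h : ∀ z, IsOpen {f : SymInv X | dilation f z = dilation s z} := by
    rintro (x | y)
    · have := isOpen_IPT x (s x)
      have e : {f : SymInv X | dilation f (.inl x) = dilation s (.inl x)} = {f | f x = s x} := by
        ext f
        rw [mem_ofPred_eq, mem_ofPred_eq]
        change dilationFun f (.inl x) = dilationFun s (.inl x) ↔ f x = s x
        cases h1 : f x <;> cases h2 : s x <;> simp [dilationFun, h1, h2]
      rwa [e]
    · have := (isOpen_IPT_inv y (s⁻¹ y))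
      have e : {f : SymInv X | dilation f (.inr y) = dilation s (.inr y)} =
          {f | f⁻¹ y = s⁻¹ y} := by
        ext f
        rw [mem_ofPred_eq, mem_ofPred_eq]
        change dilationFun f (.inr y) = dilationFun s (.inr y) ↔ f⁻¹ y = s⁻¹ y
        cases h1 : f⁻¹ y <;> cases h2 : s⁻¹ y <;> simp [dilationFun, h1, h2]
      rwa [e]
  have e : {f : SymInv X | ∀ z ∈ F, dilation f z = dilation s z} =
      ⋂ z ∈ F, {f | dilation f z = dilation s z} := by
    ext f; simp
  rw [e]
  exact hF.isOpen_biInter fun z _ => h z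

theorem continuous_of_secondCountable [Countable X] [Infinite X] {T : Type*} [Semigroup T]
    [tT : TopologicalSpace T] [ContinuousMul T] [SecondCountableTopology T] (φ : SymInv X →ₙ* T) :
    Continuous[IPT X, tT] φ := by
  obtain ⟨k⟩ := nonempty_equiv_of_countable (α := X ⊕ X) (β := X)
  let ψ : Equiv.Perm (X ⊕ X) →ₙ* T :=
    -- The inverse compensates for the order reversal in `ofPerm_mul`.
    { toFun := fun σ => φ (ofPerm k σ⁻¹)
      map_mul' := fun σ τ => by rw [mul_inv_rev, ofPerm_mul, map_mul] }
  let := IPT X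
  refine continuous_def.2 fun U hU => isOpen_iff_forall_mem_open.2 fun s hs => ?_
  -- With `s` fixed, `φ f` is a continuous function of `ψ` at a permutation that equals `1` when `f
  -- = s`, so only continuity of `ψ` at `1` is needed.
  let m : T → T := fun t => φ (inclusion k) * (t * φ (ofPerm k (dilation s))) * φ (inclusion k)⁻¹
  have hm : Continuous m :=
    (continuous_const.mul (continuous_id.mul continuous_const)).mul continuous_const
  have hφ : ∀ f, φ f = m (ψ ((dilation s)⁻¹ * dilation f)⁻¹) := fun f => by
    change φ f = φ (inclusion k) * (φ (ofPerm k ((dilation s)⁻¹ * dilation f)⁻¹⁻¹) *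
      φ (ofPerm k (dilation s))) * φ (inclusion k)⁻¹
    rw [inv_inv, ← map_mul, ← ofPerm_mul, mul_inv_cancel_left, ← map_mul, ← map_mul,
      ← eq_compression]
  have h1 : ψ 1 ∈ m ⁻¹' U := by
    have := hφ s
    rw [inv_mul_cancel, inv_one] at this
    rw [mem_preimage, ← this]
    exact hs
  obtain ⟨F, hF, hFU⟩ := exists_finite_stabilizer_preimage ψ (hU.preimage hm) h1
  refine ⟨_, fun f hf => ?_, isOpen_agree_dilation hF s, fun _ _ => rfl⟩
  rw [mem_preimage, hφ]
  refine hFU _ fun z hz => ?_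
  rw [Equiv.Perm.inv_eq_iff_eq, Equiv.Perm.mul_apply, hf z hz, ← Equiv.Perm.mul_apply,
    inv_mul_cancel, Equiv.Perm.one_apply]

end SymInv

/-! ### Compatible Fréchet topologies on the semigroup refine `LPT ∩ RPT` -/

namespace SymInv

variable {X : Type*}

theorem tendsto_LPT {Y : Type*} {g : Y → SymInv X} {l : Filter Y} {s : SymInv X}
    (h : ∀ x, ∀ᶠ z in l, g z x = s x) : Filter.Tendsto g l (@nhds _ (LPT X) s) := by
  rw [LPT, @nhds_induced _ _ (PPT X), Filter.tendsto_comap_iff, PPT,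
    TopologicalSpace.tendsto_nhds_generateFrom_iff]
  rintro _ (⟨x, y, rfl⟩ | ⟨x, rfl⟩) hs
  · filter_upwards [h x] with z hz
    exact hz.trans hs
  · filter_upwards [h x] with z hz
    exact hz.trans hs

theorem tendsto_RPT {Y : Type*} {g : Y → SymInv X} {l : Filter Y} {s : SymInv X}
    (h : ∀ x, ∀ᶠ z in l, (g z)⁻¹ x = s⁻¹ x) : Filter.Tendsto g l (@nhds _ (RPT X) s) := by
  rw [RPT, @nhds_induced _ _ (LPT X), Filter.tendsto_comap_iff]
  exact tendsto_LPT h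

theorem tendsto_CPT {Y : Type*} {g : Y → SymInv X} {l : Filter Y} {s : SymInv X}
    (h : ∀ x y, ∀ᶠ z in l, (g z x = some y ↔ s x = some y)) :
    Filter.Tendsto g l (@nhds _ (CPT X) s) := by
  rw [CPT, TopologicalSpace.tendsto_nhds_generateFrom_iff]
  rintro _ (⟨x, y, rfl⟩ | ⟨x, y, rfl⟩) hs
  · filter_upwards [h x y] with z hz
    exact hz.2 hs
  · filter_upwards [h x y] with z hz
    exact fun h' => hs (hz.1 h')

theorem exists_symInv_of_injOn {k : X → X} {Z : Set X} (hk : InjOn k Z) :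
    ∃ g : SymInv X, ∀ n ∈ Z, g n = some (k n) := by
  classical
  let j : Z ↪ X := ⟨fun n => k n, fun a b h => Subtype.ext (hk a.2 b.2 h)⟩
  let e := Equiv.ofInjective j j.injective
  refine ⟨⟨fun n => if h : n ∈ Z then some (k n) else none,
    fun m => if h : m ∈ range j then some (e.symm ⟨m, h⟩ : X) else none, fun a b => ?_⟩,
    fun n hn => dif_pos hn⟩
  constructor
  · intro h
    split_ifs at h with hb
    obtain ⟨z, rfl⟩ := hb
    have hz : e.symm ⟨j z, ⟨z, rfl⟩⟩ = z := Equiv.ofInjective_symm_apply j.injective z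
    rw [Option.some_inj, hz] at h
    subst h
    simp only [Subtype.coe_prop, dif_pos]
    rfl
  · intro h
    split_ifs at h with ha
    rw [Option.some_inj] at h
    subst h
    have hm : k a ∈ range j := ⟨⟨a, ha⟩, rfl⟩
    have hz : e.symm ⟨k a, hm⟩ = ⟨a, ha⟩ := Equiv.ofInjective_symm_apply j.injective ⟨a, ha⟩
    rw [dif_pos hm, hz]

/-- If `u` acts inside the domain of `s`, its extension by the identity outside that domain. -/
theorem exists_extend_by_id (s u : SymInv X)
    (hu : ∀ a b, u a = some b → s a ≠ none ∧ s b ≠ none) :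
    ∃ h : SymInv X, (∀ a, s a = none → h a = some a) ∧ ∀ a, s a ≠ none → h a = u a := by
  classical
  refine ⟨⟨fun a => if s a = none then some a else u a,
    fun b => if s b = none then some b else u⁻¹ b, fun a b => ?_⟩,
    fun a ha => if_pos ha, fun a ha => if_neg ha⟩
  have h1 := hu a b
  have h2 : u⁻¹ b = some a ↔ u a = some b := inv_apply_eq_some
  change (if s b = none then some b else u⁻¹ b) = some a ↔
    (if s a = none then some a else u a) = some b
  split_ifs with h3 h4 h4
  · rw [Option.some_inj, Option.some_inj, eq_comm]
  · have : a ≠ b := fun h => h4 (h ▸ h3)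
    simp only [Option.some_inj]
    exact ⟨fun h => absurd h.symm this, fun h => absurd h3 (h1 h).2⟩
  · rw [h2]
    have : a ≠ b := fun h => h3 (h ▸ h4)
    simp only [Option.some_inj]
    exact ⟨fun h => absurd h4 (h1 h).1, fun h => absurd h this⟩
  · exact h2

theorem exists_perm_disjoint [Countable X] {Z D : Set X} (hDZ : D ⊆ Z) (h : (Z \ D).Infinite) :
    ∃ g : Equiv.Perm X, (∀ n ∈ D, g n ∉ D) ∧ (∀ n ∉ Z, g n = n) := by
  have : Nonempty X := h.nonempty.to_type
  obtain ⟨b, hb⟩ := exists_bijOn (Set.infinite_univ (α := ℕ)) h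
  obtain ⟨q, hq⟩ := exists_injective_nat X
  have hinj := hb.injOn
  rw [injOn_univ] at hinj
  obtain ⟨g, hg1, hg2⟩ := exists_perm_extend (f := fun x => b (2 * q x)) hDZ
    (fun x _ => (hb.mapsTo (mem_univ _)).1)
    (fun x _ y _ hxy => hq (by have := hinj hxy; omega)) h
    ((infinite_range_of_injective (f := fun n => b (2 * n + 1))
      (fun x y hxy => by have := hinj hxy; omega)).mono (by
        rintro _ ⟨n, rfl⟩
        refine ⟨(hb.mapsTo (mem_univ _)).1, ?_⟩
        rintro ⟨x, -, hx⟩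
        have := hinj hx
        omega))
  exact ⟨g, fun n hn => hg1 n hn ▸ (hb.mapsTo (mem_univ _)).2, hg2⟩

/-- If `x` keeps entering the domain near `s`, its possible images fill almost all of an infinite
set. Otherwise a permutation of that set, compensated on the left so as to fix `s`, would push the
attained images off themselves. -/
theorem exists_infinite_forall_nhds [Countable X] {t : TopologicalSpace (SymInv X)}
    (h1 : @T1Space _ t) (h : SemigroupTopology.Semicompatible (SymInv X) t) {s : SymInv X} {x : X}
    (hx : s x = none) (hs : {f : SymInv X | f x = none} ∉ 𝓝 s) :
    ∃ Z : Set X, Z.Infinite ∧ ∀ W ∈ 𝓝 s, (Z \ {n | ∃ f ∈ W, f x = some n}).Finite := by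
  have : SeparatelyContinuousMul (SymInv X) := h
  have hC : t ≤ CPT X := le_CPT h1 h
  let P : Set (SymInv X) → Set X := fun W => {n | ∃ f ∈ W, f x = some n}
  have hP : ∀ W ∈ 𝓝 s, (P W).Nonempty := fun W hW => by
    by_contra hne
    refine hs (Filter.mem_of_superset hW fun f hf => ?_)
    rw [mem_ofPred_eq, Option.eq_none_iff_forall_ne_some]
    exact fun n hn => hne ⟨n, f, hf, hn⟩
  have hPmono : ∀ {V W : Set (SymInv X)}, V ⊆ W → P V ⊆ P W := fun hVW n ⟨f, hf, hn⟩ =>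
    ⟨f, hVW hf, hn⟩
  -- `Z` is the range of `s` or its complement, so a permutation preserving `Z` preserves the range;
  -- this is what makes the compensation possible.
  obtain ⟨Z, hZ, hPZ⟩ : ∃ Z : Set X, (Z = {n | s⁻¹ n ≠ none} ∨ Z = {n | s⁻¹ n ≠ none}ᶜ) ∧
      ∀ W ∈ 𝓝 s, (P W ∩ Z).Nonempty := by
    by_contra! hcon
    obtain ⟨V, hV, hV'⟩ := hcon _ (.inl rfl)
    obtain ⟨W, hW, hW'⟩ := hcon _ (.inr rfl)
    obtain ⟨n, hn⟩ := hP _ (Filter.inter_mem hV hW)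
    by_cases hnR : n ∈ {n | s⁻¹ n ≠ none}
    · exact (hV' ▸ (⟨hPmono inter_subset_left hn, hnR⟩ : n ∈ P V ∩ _) : n ∈ (∅ : Set X))
    · exact (hW' ▸ (⟨hPmono inter_subset_right hn, hnR⟩ : n ∈ P W ∩ _) : n ∈ (∅ : Set X))
  refine ⟨Z, fun hfin => ?_, fun W hW => ?_⟩
  · have hW : (⋂ n ∈ Z, {f : SymInv X | f x ≠ some n}) ∈ 𝓝 s := by
      refine (Filter.biInter_mem hfin).2 fun n _ => ?_
      exact (hC _ (isOpen_CPT_ne x n)).mem_nhds (by simp [hx])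
    obtain ⟨n, ⟨f, hf, hfn⟩, hn⟩ := hPZ _ hW
    exact mem_iInter₂.1 hf n hn hfn
  · by_contra hinf
    obtain ⟨g, hgD, hgZ⟩ := exists_perm_disjoint (Z := Z) (D := P W ∩ Z) inter_subset_right
      (by rwa [sdiff_inter_self_eq_sdiff])
    have hgZ' : ∀ n, g n ∈ Z ↔ n ∈ Z := fun n => by
      by_cases hn : n ∈ Z
      · refine iff_of_true ?_ hn
        by_contra hgn
        have := hgZ _ hgn
        rw [g.injective this] at hgn
        exact hgn hn
      · rw [hgZ n hn]
    have hgR : ∀ n, s⁻¹ (g n) = none ↔ s⁻¹ n = none := fun n => by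
      have := hgZ' n
      rcases hZ with rfl | rfl
      · simpa [not_iff_not] using this
      · simpa using this
    let γ : SymInv X := g.toPEquiv
    have hγ : ∀ n m, γ n = some m ↔ g n = m := fun n m => by
      simp [γ, Equiv.toPEquiv_apply]
    obtain ⟨k, hk1, hk2⟩ := exists_extend_by_id s (s * γ⁻¹ * s⁻¹) (by
      intro a b hab
      obtain ⟨n, hn, hb⟩ := mul_eq_some.1 hab
      obtain ⟨m, hm, -⟩ := mul_eq_some.1 hn
      rw [inv_apply_eq_some] at hb
      simp [hm, hb])
    have hks : k * s * γ = s := by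
      refine PEquiv.ext fun a => ?_
      rw [mul_apply, mul_apply]
      cases ha : s a with
      | none => simp [hk1 a ha, ha]
      | some n =>
        obtain ⟨m, rfl⟩ := g.surjective n
        have hne : s⁻¹ m ≠ none := by
          rw [ne_eq, ← hgR, inv_apply_eq_some.2 ha]
          simp
        obtain ⟨c, hc⟩ := Option.ne_none_iff_exists'.1 hne
        have : (s * γ⁻¹ * s⁻¹) a = some c :=
          mul_eq_some.2 ⟨m, mul_eq_some.2 ⟨g m, ha, inv_apply_eq_some.2 ((hγ _ _).2 rfl)⟩, hc⟩
        rw [hk2 a (by simp [ha]), this, Option.bind_some, inv_apply_eq_some.1 hc,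
          Option.bind_some, hγ]
    have hcont : Continuous fun f : SymInv X => k * f * γ :=
      (continuous_mul_const γ).comp (continuous_const_mul k)
    have hW' : (fun f : SymInv X => k * f * γ) ⁻¹' W ∈ 𝓝 s :=
      hcont.continuousAt (by rwa [hks])
    -- Both `f` and `k * f * γ` lie in `W`, and `k` fixes `x`, so `n` and `g n` are both attained in
    -- `Z`, against the choice of `g`.
    obtain ⟨n, ⟨f, hf, hfn⟩, hnZ⟩ := hPZ _ (Filter.inter_mem hW hW')
    refine hgD n ⟨⟨f, hf.1, hfn⟩, hnZ⟩ ⟨⟨_, hf.2, ?_⟩, (hgZ' n).2 hnZ⟩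
    exact mul_eq_some.2 ⟨n, mul_eq_some.2 ⟨x, hk1 x hx, hfn⟩, (hγ _ _).2 rfl⟩

theorem t1Space_induced_inv {t : TopologicalSpace (SymInv X)} (h1 : @T1Space _ t) :
    @T1Space _ (t.induced fun f => f⁻¹) :=
  @t1Space_of_injective_of_continuous _ _ (t.induced fun f => f⁻¹) t _ inv_injective
    continuous_induced_dom h1

theorem mem_nhds_induced_inv {t : TopologicalSpace (SymInv X)} {W : Set (SymInv X)}
    {s : SymInv X} : {f | f⁻¹ ∈ W} ∈ @nhds _ (t.induced fun f => f⁻¹) s⁻¹ ↔ W ∈ 𝓝 s := by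
  rw [nhds_induced, inv_inv, Filter.mem_comap]
  refine ⟨fun ⟨V, hV, hVW⟩ => Filter.mem_of_superset hV fun f hf => ?_,
    fun hW => ⟨W, hW, subset_rfl⟩⟩
  have : f⁻¹⁻¹ ∈ W := hVW (show f⁻¹⁻¹ ∈ V by rwa [inv_inv])
  rwa [inv_inv] at this

/-- This is where joint continuity is used: it is applied to `(f, f') ↦ f * g * f'` at `(s, s)`,
with `g` matching almost all images of `x` to almost all preimages of `y`. -/
theorem mem_nhds_none_or_mem_nhds_inv_none [Countable X] {t : TopologicalSpace (SymInv X)}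
    (h1 : @T1Space _ t) (h : SemigroupTopology.Compatible (SymInv X) t) {s : SymInv X} {x y : X}
    (hx : s x = none) (hy : s⁻¹ y = none) :
    {f : SymInv X | f x = none} ∈ 𝓝 s ∨ {f : SymInv X | f⁻¹ y = none} ∈ 𝓝 s := by
  have : ContinuousMul (SymInv X) := h
  have : Nonempty X := ⟨x⟩
  by_contra! hcon
  obtain ⟨Z, hZ, hZP⟩ := exists_infinite_forall_nhds h1 (Compatible.semicompatible h) hx hcon.1
  obtain ⟨Z', hZ', hZQ⟩ : ∃ Z' : Set X, Z'.Infinite ∧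
      ∀ W ∈ 𝓝 s, (Z' \ {n | ∃ f ∈ W, f⁻¹ y = some n}).Finite := by
    obtain ⟨Z', hZ', hZQ⟩ := @exists_infinite_forall_nhds X _ _ (t1Space_induced_inv h1)
      (Compatible.semicompatible (compatible_induced_inv h)) s⁻¹ y hy
      (fun hmem => hcon.2 (mem_nhds_induced_inv.1 (by simpa only [mem_ofPred_eq, inv_inv] using hmem)))
    refine ⟨Z', hZ', fun W hW => ?_⟩
    have := hZQ _ (mem_nhds_induced_inv.2 hW)
    refine this.subset (sdiff_subset_sdiff_right ?_)
    rintro n ⟨f, hf, hn⟩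
    exact ⟨f⁻¹, hf, by simpa using hn⟩
  obtain ⟨k, hk⟩ := exists_bijOn hZ hZ'
  obtain ⟨g, hg⟩ := exists_symInv_of_injOn hk.injOn
  have hcont : Continuous fun p : SymInv X × SymInv X => p.1 * g * p.2 :=
    (continuous_fst.mul continuous_const).mul continuous_snd
  have hopen := (le_CPT h1 (Compatible.semicompatible h)) _ (isOpen_CPT_ne x y)
  have hnh : (fun p : SymInv X × SymInv X => p.1 * g * p.2) ⁻¹' {f | f x ≠ some y} ∈
      𝓝 (s, s) := (hopen.preimage hcont).mem_nhds (by simp [mul_apply, hx])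
  rw [nhds_prod_eq, Filter.mem_prod_same_iff] at hnh
  obtain ⟨W, hW, hWW⟩ := hnh
  have hfin : ({n ∈ Z | k n ∈ Z' \ {n | ∃ f ∈ W, f⁻¹ y = some n}}).Finite :=
    
    Set.Finite.of_injOn (fun _ h => h.2) (hk.injOn.mono fun _ h => h.1) (hZQ W hW)
  obtain ⟨n, hn, hn'⟩ := hZ.exists_notMem_finite ((hZP W hW).union hfin)
  simp only [mem_union, mem_sdiff, mem_ofPred_eq, hn, hk.mapsTo hn, true_and, not_or,
    not_not] at hn'
  obtain ⟨⟨f, hf, hfn⟩, f', hf', hfn'⟩ := hn'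
  exact hWW (mk_mem_prod hf hf')
    (mul_eq_some.2 ⟨_, mul_eq_some.2 ⟨n, hfn, hg n hn⟩, inv_apply_eq_some.1 hfn'⟩)

/-- Every compatible Fréchet topology refines the intersection of `LPT` and `RPT`. -/
theorem le_interLRPT [Countable X] {t : TopologicalSpace (SymInv X)}
    (h1 : @T1Space _ t) (h : SemigroupTopology.Compatible (SymInv X) t) : t ≤ interLRPT X := by
  have hC : t ≤ CPT X := le_CPT h1 (Compatible.semicompatible h)
  intro U hU
  obtain ⟨hUL, hUR⟩ : IsOpen[LPT X] U ∧ IsOpen[RPT X] U := hU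
  rw [isOpen_iff_mem_nhds]
  intro s hs
  -- A single bad `x` at `s` forces the good alternative for every `y` outside the range, so one of
  -- the two refinements holds at `s`.
  by_cases hL : ∀ x, s x = none → {f : SymInv X | f x = none} ∈ 𝓝 s
  · refine tendsto_LPT (g := id) (l := 𝓝 s) (fun x => ?_)
      (@IsOpen.mem_nhds _ (LPT X) _ _ hUL hs)
    cases hx : s x with
    | none => exact hL x hx
    | some y => exact (hC _ (isOpen_CPT_some x y)).mem_nhds hx
  · push Not at hL
    obtain ⟨x, hx, hx'⟩ := hL
    refine tendsto_RPT (g := id) (l := 𝓝 s) (fun y => ?_)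
      (@IsOpen.mem_nhds _ (RPT X) _ _ hUR hs)
    cases hy : s⁻¹ y with
    | none => exact (mem_nhds_none_or_mem_nhds_inv_none h1 h hx hy).resolve_left hx'
    | some z =>
      filter_upwards [(hC _ (isOpen_CPT_some z y)).mem_nhds (inv_apply_eq_some.1 hy)] with f hf
      exact inv_apply_eq_some.2 hf

end SymInv

/-! ### Identification of the canonical topologies and strictness -/

namespace SymInv

variable {X : Type*}

theorem compatible_IPT (X : Type*) : InverseSemigroupTopology.Compatible (SymInv X) (IPT X) :=
  ⟨continuousMul_IPT X, continuousInv_IPT X⟩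

theorem interLRPT_le_CPT (X : Type*) : interLRPT X ≤ CPT X :=
  sup_le (LPT_le_CPT X) (RPT_le_CPT X)

theorem IPT_le_interLRPT (X : Type*) : IPT X ≤ interLRPT X :=
  (IPT_le_LPT X).trans le_sup_left

theorem t2Space_IPT (X : Type*) : @T2Space _ (IPT X) :=
  t2Space_of_le_CPT ((IPT_le_LPT X).trans (LPT_le_CPT X))

theorem t1Space_CPT (X : Type*) : @T1Space _ (CPT X) :=
  @T2Space.t1Space _ (CPT X) (t2Space_CPT X)

theorem CPT_eq_MF (X : Type*) : CPT X = SemigroupTopology.MF (SymInv X) :=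
  le_antisymm (le_sSup ⟨t1Space_CPT X, semicompatible_CPT X⟩) (sSup_le fun _ ht => le_CPT ht.1 ht.2)

theorem CPT_eq_inverse_MF (X : Type*) : CPT X = InverseSemigroupTopology.MF (SymInv X) :=
  CPT_eq_MF X

theorem inverse_HM_le_FM (X : Type*) :
    InverseSemigroupTopology.HM (SymInv X) ≤ InverseSemigroupTopology.FM (SymInv X) :=
  sSup_le_sSup fun t ht => ⟨@T2Space.t1Space _ t ht.1, ht.2⟩

theorem HM_le_FM (X : Type*) :
    SemigroupTopology.HM (SymInv X) ≤ SemigroupTopology.FM (SymInv X) :=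
  sSup_le_sSup fun t ht => ⟨@T2Space.t1Space _ t ht.1, ht.2⟩

theorem inverse_FM_eq_IPT (X : Type*) : InverseSemigroupTopology.FM (SymInv X) = IPT X :=
  le_antisymm (sSup_le fun _ ht => le_IPT ht.1 ht.2)
    (le_sSup ⟨@T2Space.t1Space _ (IPT X) (t2Space_IPT X), compatible_IPT X⟩)

theorem inverse_HM_eq_IPT (X : Type*) : InverseSemigroupTopology.HM (SymInv X) = IPT X :=
  le_antisymm ((inverse_HM_le_FM X).trans (inverse_FM_eq_IPT X).le)
    (le_sSup ⟨t2Space_IPT X, compatible_IPT X⟩)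

theorem interLRPT_le_HM (X : Type*) : interLRPT X ≤ SemigroupTopology.HM (SymInv X) :=
  sup_le (le_sSup ⟨t2Space_of_le_CPT (LPT_le_CPT X), continuousMul_LPT X⟩)
    (le_sSup ⟨t2Space_of_le_CPT (RPT_le_CPT X), continuousMul_RPT X⟩)

theorem FM_le_interLRPT (X : Type*) [Countable X] :
    SemigroupTopology.FM (SymInv X) ≤ interLRPT X :=
  sSup_le fun _ ht => le_interLRPT ht.1 ht.2

theorem FM_eq_interLRPT (X : Type*) [Countable X] :
    SemigroupTopology.FM (SymInv X) = interLRPT X :=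
  le_antisymm (FM_le_interLRPT X) ((interLRPT_le_HM X).trans (HM_le_FM X))

theorem HM_eq_interLRPT (X : Type*) [Countable X] :
    SemigroupTopology.HM (SymInv X) = interLRPT X :=
  le_antisymm ((HM_le_FM X).trans (FM_le_interLRPT X)) (interLRPT_le_HM X)

theorem secondCountableTopology_IPT (X : Type*) [Countable X] :
    @SecondCountableTopology _ (IPT X) :=
  (polishSpace_IPT X).toSecondCountableTopology

theorem IPT_le_of_secondCountable [Countable X] [Infinite X] {t : TopologicalSpace (SymInv X)}
    (h1 : @SecondCountableTopology _ t) (h : SemigroupTopology.Compatible (SymInv X) t) :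
    IPT X ≤ t :=
  continuous_id_iff_le.1 <|
    @continuous_of_secondCountable X _ _ (SymInv X) _ t h h1 (MulHom.id (SymInv X))

theorem SCC_eq_IPT (X : Type*) [Countable X] [Infinite X] :
    SemigroupTopology.SCC (SymInv X) = IPT X :=
  le_antisymm (sInf_le ⟨secondCountableTopology_IPT X, continuousMul_IPT X⟩)
    (le_sInf fun _ ht => IPT_le_of_secondCountable ht.1 ht.2)

theorem inverse_SCC_eq_IPT (X : Type*) [Countable X] [Infinite X] :
    InverseSemigroupTopology.SCC (SymInv X) = IPT X :=
  le_antisymm (sInf_le ⟨secondCountableTopology_IPT X, compatible_IPT X⟩)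
    (le_sInf fun _ ht => IPT_le_of_secondCountable ht.1 ht.2.1)

/-- The set of partial bijections that interchange `x` with no point is open. -/
theorem isOpen_interLRPT_no_interchange (x : X) :
    IsOpen[interLRPT X] {f : SymInv X | ∀ n, f x = some n → f n ≠ some x} := by
  have hL : IsOpen[LPT X] {f : SymInv X | ∀ n, f x = some n → f n ≠ some x} := by
    let := LPT X
    have e : {f : SymInv X | ∀ n, f x = some n → f n ≠ some x} =
        {f | f x = none} ∪ ⋃ n, {f | f x = some n} ∩ {f | f n ≠ some x} := by
      ext f
      cases h : f x <;> simp [h]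
    rw [e]
    exact (isOpen_LPT x none).union (isOpen_iUnion fun n =>
      (isOpen_LPT x _).inter (LPT_le_CPT X _ (isOpen_CPT_ne n x)))
  refine ⟨hL, ?_⟩
  -- The condition is invariant under inversion, so openness in `LPT` gives openness in `RPT`.
  have hinv : {f : SymInv X | ∀ n, f x = some n → f n ≠ some x} =
      (fun f => f⁻¹) ⁻¹' {f : SymInv X | ∀ n, f x = some n → f n ≠ some x} := by
    ext f
    simp only [mem_ofPred_eq, mem_preimage, ne_eq, inv_apply_eq_some]
    exact forall_congr' fun n => ⟨fun h h1 h2 => h h2 h1, fun h h1 h2 => h h2 h1⟩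
  rw [hinv]
  exact @isOpen_induced _ _ (LPT X) _ _ hL

/-- In `CPT` the transpositions of `0` and `n` converge to the identity off `0`, which interchanges
`0` with nothing. -/
theorem not_CPT_le_interLRPT : ¬ CPT ℕ ≤ interLRPT ℕ := by
  intro h
  let g : ℕ → SymInv ℕ := fun n => (Equiv.swap 0 n).toPEquiv
  have hlim : Filter.Tendsto g Filter.atTop (@nhds _ (CPT ℕ) (PEquiv.ofSet {0}ᶜ)) := by
    refine tendsto_CPT fun x y => ?_
    filter_upwards [Filter.eventually_gt_atTop (max x y)] with n hn
    have hxn : x ≠ n := by omega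
    have hyn : n ≠ y := by omega
    simp only [g, Equiv.toPEquiv_apply, Option.some_inj]
    by_cases hx : x = 0
    · subst hx
      simp [hyn, PEquiv.ofSet]
    · rw [Equiv.swap_apply_of_ne_of_ne hx hxn]
      simp [PEquiv.ofSet, hx]
  have hopen := h _ (isOpen_interLRPT_no_interchange (0 : ℕ))
  have hev := hlim (@IsOpen.mem_nhds _ (CPT ℕ) _ _ hopen (by simp [PEquiv.ofSet]))
  obtain ⟨n, hn⟩ := Filter.nonempty_of_mem (Filter.mem_map.1 hev)
  exact hn n (by simp [g, Equiv.toPEquiv_apply]) (by simp [g, Equiv.toPEquiv_apply])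

/-- In `RPT` the maps `{(0, n)}` converge to the empty map, yet all have `0` in their domain. -/
theorem not_interLRPT_le_IPT : ¬ interLRPT ℕ ≤ IPT ℕ := by
  intro h
  have hR : RPT ℕ ≤ IPT ℕ := le_sup_right.trans h
  let g : ℕ → SymInv ℕ := fun n => PEquiv.single 0 n
  have hlim : Filter.Tendsto g Filter.atTop (@nhds _ (RPT ℕ) ⊥) := by
    refine tendsto_RPT fun x => ?_
    filter_upwards [Filter.eventually_gt_atTop x] with n hn
    simp only [g, inv_def, PEquiv.symm_single, PEquiv.symm_bot, PEquiv.bot_apply]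
    exact PEquiv.single_apply_of_ne hn.ne' 0
  have hev := hlim (@IsOpen.mem_nhds _ (RPT ℕ) _ _ (hR _ (isOpen_IPT (0 : ℕ) none)) rfl)
  obtain ⟨n, hn⟩ := Filter.nonempty_of_mem (Filter.mem_map.1 hev)
  have h1 : g n 0 = none := hn
  simp [g] at h1

end SymInv

end

theorem theorem9p18 :
    -- the inverse pointwise topology is Polish
    @PolishSpace (SymInv ℕ) (SymInv.IPT ℕ) ∧
    -- it is a second countable Fréchet topology compatible with the inverse semigroup,
    -- and it is the only one
    (∀ t : TopologicalSpace (SymInv ℕ),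
      (@SecondCountableTopology (SymInv ℕ) t ∧ @T1Space (SymInv ℕ) t ∧
        InverseSemigroupTopology.Compatible (SymInv ℕ) t) ↔ t = SymInv.IPT ℕ) ∧
    -- the chain for the inverse semigroup
    (SymInv.CPT ℕ = InverseSemigroupTopology.MF (SymInv ℕ) ∧
      openFamily (InverseSemigroupTopology.MF (SymInv ℕ)) ⊂
        openFamily (InverseSemigroupTopology.FM (SymInv ℕ)) ∧
      InverseSemigroupTopology.FM (SymInv ℕ) = InverseSemigroupTopology.HM (SymInv ℕ) ∧
      InverseSemigroupTopology.HM (SymInv ℕ) = InverseSemigroupTopology.SCC (SymInv ℕ) ∧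
      InverseSemigroupTopology.SCC (SymInv ℕ) = SymInv.IPT ℕ) ∧
    -- the chain for the underlying semigroup
    (SymInv.CPT ℕ = SemigroupTopology.MF (SymInv ℕ) ∧
      openFamily (SemigroupTopology.MF (SymInv ℕ)) ⊂ openFamily (SymInv.interLRPT ℕ) ∧
      SymInv.interLRPT ℕ = SemigroupTopology.FM (SymInv ℕ) ∧
      SemigroupTopology.FM (SymInv ℕ) = SemigroupTopology.HM (SymInv ℕ) ∧
      openFamily (SemigroupTopology.HM (SymInv ℕ)) ⊂
        openFamily (SemigroupTopology.SCC (SymInv ℕ)) ∧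
      SemigroupTopology.SCC (SymInv ℕ) = SymInv.IPT ℕ) ∧
    -- automatic continuity
    (∀ (T : Type*) [Semigroup T] [tT : TopologicalSpace T] [ContinuousMul T]
        [SecondCountableTopology T] (φ : SymInv ℕ →ₙ* T),
      @Continuous (SymInv ℕ) T (SymInv.IPT ℕ) tT φ) := by
  refine ⟨SymInv.polishSpace_IPT ℕ, fun t => ⟨fun ⟨h1, h2, h3⟩ => ?_, ?_⟩,
    ⟨SymInv.CPT_eq_inverse_MF ℕ, ?_, ?_, ?_, SymInv.inverse_SCC_eq_IPT ℕ⟩,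
    ⟨SymInv.CPT_eq_MF ℕ, ?_, (SymInv.FM_eq_interLRPT ℕ).symm, ?_, ?_, SymInv.SCC_eq_IPT ℕ⟩, ?_⟩
  · exact le_antisymm (SymInv.le_IPT h2 h3) (SymInv.IPT_le_of_secondCountable h1 h3.1)
  · rintro rfl
    exact ⟨SymInv.secondCountableTopology_IPT ℕ,
      @T2Space.t1Space _ (SymInv.IPT ℕ) (SymInv.t2Space_IPT ℕ), SymInv.compatible_IPT ℕ⟩
  · rw [← SymInv.CPT_eq_inverse_MF, SymInv.inverse_FM_eq_IPT]
    exact ⟨(SymInv.IPT_le_interLRPT ℕ).trans (SymInv.interLRPT_le_CPT ℕ), fun h =>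
      SymInv.not_CPT_le_interLRPT (le_trans h (SymInv.IPT_le_interLRPT ℕ))⟩
  · rw [SymInv.inverse_FM_eq_IPT, SymInv.inverse_HM_eq_IPT]
  · rw [SymInv.inverse_HM_eq_IPT, SymInv.inverse_SCC_eq_IPT]
  · rw [← SymInv.CPT_eq_MF]
    exact ⟨SymInv.interLRPT_le_CPT ℕ, SymInv.not_CPT_le_interLRPT⟩
  · rw [SymInv.FM_eq_interLRPT, SymInv.HM_eq_interLRPT]
  · rw [SymInv.HM_eq_interLRPT, SymInv.SCC_eq_IPT]
    exact ⟨SymInv.IPT_le_interLRPT ℕ, SymInv.not_interLRPT_le_IPT⟩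
  · intro T _ _ _ _ φ
    exact SymInv.continuous_of_secondCountable φ
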